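/- Let $\mathfrak g$ be a $5$-dimensional complex Lie algebra with a $3$-dimensional abelian ideal $\mathfrak a$. Let $(\mathfrak g;\mathfrak e,\mathfrak f)$ be an ILC triple, that is, $\mathfrak e,\mathfrak f\subset\mathfrak g$ are $2$-dimensional complex subalgebras with $\mathfrak e\cap\mathfrak f=0$ such that, for $C:=\mathfrak e\oplus\mathfrak f$, the skew form $\bigwedge^2 C\to\mathfrak g/C$, $x\wedge y\mapsto [x,y] \bmod C$, is non-degenerate. Let $\tau$ be an admissible anti-involution of it (so that the triple is anti-self-dual), that is, a conjugate-linear map $\tau:\mathfrak g\to\mathfrak g$ with $\tau[x,y]=[\tau x,\tau y]$ for all $x,y$, $\tau^2=\mathrm{id}$, $\tau(\mathfrak e)=\mathfrak f$ and $\tau(\mathfrak f)=\mathfrak e$. Let $G$ be any complex Lie group with Lie algebra $\mathfrak g$, and let $E,F\subset TG$ be the left-invariant holomorphic distributions determined by $\mathfrak e$ and $\mathfrak f$. The ILC symmetry dimension of $(\mathfrak g;\mathfrak e,\mathfrak f)$ is the complex dimension of the space of germs at the identity of $G$ of holomorphic vector fields $\xi$ that preserve both $E$ and $F$, i.e. such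 that $[\xi,Y]$ is a section of $E$ (respectively $F$) for every local holomorphic section $Y$ of $E$ (respectively $F$). If the ILC symmetry dimension of $(\mathfrak g;\mathfrak e,\mathfrak f)$ equals $5$, then $\tau(\mathfrak a)=\mathfrak a$ and $\mathfrak e\cap\mathfrak a=\mathfrak f\cap\mathfrak a=0$. -/

import Mathlib

open scoped Manifold ContDiff Topology

/-! ### Legendrian contact triples on a complex Lie algebra -/

section Algebra

variable {𝔤 : Type*} [LieRing 𝔤] [LieAlgebra ℂ 𝔤]

/-- `(𝔤; 𝔢, 𝔣)` is an ILC triple: `𝔤` has dimension five, `𝔢` and `𝔣` are two-dimensional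
subalgebras with `𝔢 ∩ 𝔣 = 0`, and for `C = 𝔢 ⊕ 𝔣` the skew form
`C × C → 𝔤 / C, (x, y) ↦ [x, y] mod C` is non-degenerate. -/
structure IsILCTriple (𝔢 𝔣 : LieSubalgebra ℂ 𝔤) : Prop where
  finrank_eq : Module.finrank ℂ 𝔤 = 5
  finrank_left : Module.finrank ℂ 𝔢 = 2
  finrank_right : Module.finrank ℂ 𝔣 = 2
  inf_eq_bot : 𝔢.toSubmodule ⊓ 𝔣.toSubmodule = ⊥
  nondegenerate : ∀ x ∈ 𝔢.toSubmodule ⊔ 𝔣.toSubmodule,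
    (∀ y ∈ 𝔢.toSubmodule ⊔ 𝔣.toSubmodule, ⁅x, y⁆ ∈ 𝔢.toSubmodule ⊔ 𝔣.toSubmodule) → x = 0

/-- The conjugate-linear map `τ` is an admissible anti-involution of `(𝔤; 𝔢, 𝔣)`: it preserves
brackets, squares to the identity, and swaps `𝔢` and `𝔣`. -/
structure IsAdmissibleAntiInvolution (𝔢 𝔣 : LieSubalgebra ℂ 𝔤)
    (τ : 𝔤 →ₛₗ[starRingEnd ℂ] 𝔤) : Prop where
  map_lie : ∀ x y : 𝔤, τ ⁅x, y⁆ = ⁅τ x, τ y⁆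
  involutive : Function.Involutive τ
  map_left : 𝔢.toSubmodule.map τ = 𝔣.toSubmodule
  map_right : 𝔣.toSubmodule.map τ = 𝔢.toSubmodule

end Algebra

/-! ### Infinitesimal symmetries of a pair of distributions on a complex manifold -/

section Manifold

variable {E : Type*} [NormedAddCommGroup E] [NormedSpace ℂ E]
  {M : Type*} [TopologicalSpace M] [ChartedSpace E M]

/-- The vector field `ξ` on the complex manifold `M` is holomorphic near the point `q`. -/
def HolomorphicVectorFieldAt [IsManifold 𝓘(ℂ, E) ω M]
    (ξ : Π x : M, TangentSpace 𝓘(ℂ, E) x) (q : M) : Prop :=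
  ContMDiffAt 𝓘(ℂ, E) 𝓘(ℂ, E).tangent ω
    (fun x => (⟨x, ξ x⟩ : TangentBundle 𝓘(ℂ, E) M)) q

/-- The Lie derivative along `ξ` maps local holomorphic sections of the distribution `D` around
`q` to vector fields whose value at `q` lies in `D`. -/
def PreservesDistributionAt [IsManifold 𝓘(ℂ, E) ω M]
    (D : Π x : M, Submodule ℂ (TangentSpace 𝓘(ℂ, E) x))
    (ξ : Π x : M, TangentSpace 𝓘(ℂ, E) x) (q : M) : Prop :=
  ∀ Y : Π x : M, TangentSpace 𝓘(ℂ, E) x, HolomorphicVectorFieldAt Y q →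
    (∀ᶠ x in 𝓝 q, Y x ∈ D x) → VectorField.mlieBracket 𝓘(ℂ, E) ξ Y q ∈ D q

/-- The vector fields that are, on some neighbourhood of `p`, holomorphic infinitesimal symmetries
of the pair of distributions `(D₁, D₂)`. No condition is imposed away from `p`. -/
def localSymmetries [CompleteSpace E] [IsManifold 𝓘(ℂ, E) ω M]
    (D₁ D₂ : Π x : M, Submodule ℂ (TangentSpace 𝓘(ℂ, E) x)) (p : M) :
    Submodule ℂ (Π x : M, TangentSpace 𝓘(ℂ, E) x) where
  carrier := {ξ | ∀ᶠ q in 𝓝 p, HolomorphicVectorFieldAt ξ q ∧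
    PreservesDistributionAt D₁ ξ q ∧ PreservesDistributionAt D₂ ξ q}
  add_mem' := by
    intro ξ ζ hξ hζ
    filter_upwards [hξ, hζ] with q hq hq'
    have hd := hq.1.mdifferentiableAt (by simp)
    have hd' := hq'.1.mdifferentiableAt (by simp)
    refine ⟨hq.1.add_section hq'.1, fun Y hY hYD => ?_, fun Y hY hYD => ?_⟩
    · rw [VectorField.mlieBracket_add_left hd hd']
      exact add_mem (hq.2.1 Y hY hYD) (hq'.2.1 Y hY hYD)
    · rw [VectorField.mlieBracket_add_left hd hd']
      exact add_mem (hq.2.2 Y hY hYD) (hq'.2.2 Y hY hYD)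
  zero_mem' := by
    refine Filter.Eventually.of_forall fun q => ⟨?_, fun Y _ _ => ?_, fun Y _ _ => ?_⟩
    · exact Bundle.contMDiff_zeroSection ℂ (TangentSpace 𝓘(ℂ, E)) q
    · rw [VectorField.mlieBracket_zero_left]; exact zero_mem _
    · rw [VectorField.mlieBracket_zero_left]; exact zero_mem _
  smul_mem' := by
    intro c ξ hξ
    filter_upwards [hξ] with q hq
    have hd := hq.1.mdifferentiableAt (by simp)
    refine ⟨hq.1.const_smul_section, fun Y hY hYD => ?_, fun Y hY hYD => ?_⟩
    · rw [VectorField.mlieBracket_const_smul_left hd]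
      exact Submodule.smul_mem _ c (hq.2.1 Y hY hYD)
    · rw [VectorField.mlieBracket_const_smul_left hd]
      exact Submodule.smul_mem _ c (hq.2.2 Y hY hYD)

/-- The vector fields that vanish identically on some neighbourhood of `p`. -/
def vanishingNear (p : M) : Submodule ℂ (Π x : M, TangentSpace 𝓘(ℂ, E) x) where
  carrier := {ξ | ∀ᶠ q in 𝓝 p, ξ q = 0}
  add_mem' := by
    intro ξ ζ hξ hζ
    filter_upwards [hξ, hζ] with q hq hq'
    rw [Pi.add_apply, hq, hq', add_zero]
  zero_mem' := Filter.Eventually.of_forall fun _ => rfl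
  smul_mem' := by
    intro c ξ hξ
    filter_upwards [hξ] with q hq
    rw [Pi.smul_apply, hq, smul_zero]

/-- The complex vector space of germs at `p` of holomorphic infinitesimal symmetries of
`(M; D₁, D₂)`. -/
abbrev SymmetryGerms [CompleteSpace E] [IsManifold 𝓘(ℂ, E) ω M]
    (D₁ D₂ : Π x : M, Submodule ℂ (TangentSpace 𝓘(ℂ, E) x)) (p : M) : Type _ :=
  localSymmetries D₁ D₂ p ⧸ (vanishingNear p).comap (localSymmetries D₁ D₂ p).subtype

end Manifold

/-! ### The left-invariant structure on a complex Lie group -/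

section LieGroup

variable {E : Type*} [NormedAddCommGroup E] [NormedSpace ℂ E]
  {G : Type*} [TopologicalSpace G] [ChartedSpace E G] [Group G]

/-- The left-invariant distribution on `G` determined by a subspace `V` of its Lie algebra: at `x`
it consists of the left translates to `x` of the vectors in `V`. -/
def leftInvariantDistribution (V : Submodule ℂ (GroupLieAlgebra 𝓘(ℂ, E) G)) (x : G) :
    Submodule ℂ (TangentSpace 𝓘(ℂ, E) x) where
  carrier := {w | ∃ v ∈ V, mulInvariantVectorField v x = w}
  add_mem' := by
    rintro _ _ ⟨v, hv, rfl⟩ ⟨w, hw, rfl⟩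
    exact ⟨v + w, add_mem hv hw, congrFun (mulInvariantVectorField_add v w) x⟩
  zero_mem' := ⟨0, zero_mem V, by
    simpa using congrFun (mulInvariantVectorField_smul (I := 𝓘(ℂ, E)) (G := G) (0 : ℂ) 0) x⟩
  smul_mem' := by
    rintro c _ ⟨v, hv, rfl⟩
    exact ⟨c • v, V.smul_mem c hv, congrFun (mulInvariantVectorField_smul c v) x⟩

/-- The ILC symmetry dimension of `(𝔤; 𝔢, 𝔣)`, computed on a complex Lie group `G` whose Lie
algebra is identified with `𝔤` by `ι`: the dimension of the space of germs at the identity of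
holomorphic vector fields preserving both left-invariant distributions determined by `𝔢` and `𝔣`. -/
noncomputable def ilcSymDim [CompleteSpace E] [LieGroup 𝓘(ℂ, E) ω G]
    {𝔤 : Type*} [LieRing 𝔤] [LieAlgebra ℂ 𝔤]
    (ι : 𝔤 ≃ₗ⁅ℂ⁆ GroupLieAlgebra 𝓘(ℂ, E) G) (𝔢 𝔣 : LieSubalgebra ℂ 𝔤) : Cardinal :=
  Module.rank ℂ (SymmetryGerms
    (leftInvariantDistribution (G := G) (𝔢.toSubmodule.map ι.toLinearEquiv.toLinearMap))
    (leftInvariantDistribution (G := G) (𝔣.toSubmodule.map ι.toLinearEquiv.toLinearMap)) (1 : G))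

end LieGroup

/-!
Let `D` be a nonzero derivation of `𝔤`, twisted by a character `φ`, that maps `𝔢` and `𝔣` into
themselves. The pair `(D, φ)` extends the adjoint representation of `𝔤` to `𝔤 ⊕ ℂ`, and such a
representation is a flat connection in the left-invariant frame of `G`. The derivative of the
`𝔤`-component of a parallel section along `x` differs from a bracket with `x` by a multiple of
`D x`, so this component is an infinitesimal symmetry of both distributions. As `𝔤` has a
codimension-two abelian ideal it is solvable, and by Lie's theorem the parallel sections are
obtained by integrating one closed scalar one-form at a time. Since `D ≠ 0`, the `dim 𝔤 + 1 = 6`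
independent sections give six independent germs, contradicting symmetry dimension `5`.

Hence `𝔤` admits no such `D`. If `τ 𝔞 ≠ 𝔞`, the abelian ideals `𝔞` and `τ 𝔞` meet in a line or in
a plane; if `τ 𝔞 = 𝔞` and `𝔢` meets `𝔞` in a line, then `τ` and the Jacobi identity restrict the
structure constants. In each case a twisted derivation preserving `𝔢` and `𝔣` can be written down.
-/

/-! ### Parallel sections of flat connections -/

section Primitive

variable {E F : Type*} [NormedAddCommGroup E] [NormedSpace ℂ E] [NormedAddCommGroup F]
  [NormedSpace ℂ F] {f : E → F} {f' : E → E →L[ℂ] F} {x : E}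
  {p : FormalMultilinearSeries ℂ E (E →L[ℂ] F)} {r : ENNReal}

theorem add_smul_mem_eball {y : E} {t : ℂ} (ht : t ∈ Metric.eball (0 : ℂ) (r / ‖y‖ₑ)) :
    x + t • y ∈ Metric.eball x r := by
  have : ‖t‖ₑ * ‖y‖ₑ < r := ENNReal.mul_lt_of_lt_div (mem_eball_zero_iff.1 ht)
  simpa [edist_eq_enorm_sub, enorm_smul] using this

theorem iteratedDeriv_comp_line [CompleteSpace F] (hf' : HasFPowerSeriesOnBall f' p x r) (y : E)
    (n : ℕ) :
    iteratedDeriv n (fun t : ℂ => f' (x + t • y) y) 0 = (n.factorial : ℂ) • p n (fun _ => y) y := by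
  let u : ℂ →L[ℂ] E := .toSpanSingleton ℂ y
  have hshift : HasFPowerSeriesOnBall (fun z => f' (x + z)) p (u 0) r := by
    simpa [add_comm] using hf'.comp_sub (-x)
  have hline := ((ContinuousLinearMap.apply ℂ F y).comp_hasFPowerSeriesOnBall
    hshift).compContinuousLinearMap
  calc iteratedDeriv n (fun t : ℂ => f' (x + t • y) y) 0
      = iteratedFDeriv ℂ n (fun t : ℂ => f' (x + t • y) y) 0 (fun _ => 1) :=
        iteratedDeriv_eq_iteratedFDeriv
    _ = _ := (hline.factorial_smul 1 n).symm
    _ = (n.factorial : ℂ) • p n (fun _ => y) y := by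
        simp [u, Nat.cast_smul_eq_nsmul, FormalMultilinearSeries.compContinuousLinearMap_apply,
          -FormalMultilinearSeries.apply_eq_prod_smul_coeff, Function.comp_def]

/- Along the complex line through `x` and `x + y` the function `f` is holomorphic, hence equal to
its Taylor series, whose coefficients are read off from those of `f'`. -/
theorem hasSum_sub_of_hasFDerivAt [CompleteSpace F] (hf' : HasFPowerSeriesOnBall f' p x r)
    (hf : ∀ y ∈ Metric.eball x r, HasFDerivAt f (f' y) y) {y : E} (hy : y ∈ Metric.eball 0 r) :
    HasSum (fun n : ℕ => (n + 1 : ℂ)⁻¹ • p n (fun _ => y) y) (f (x + y) - f x) := by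
  let g : ℂ → F := fun t => f (x + t • y)
  have hg : ∀ t ∈ Metric.eball (0 : ℂ) (r / ‖y‖ₑ), HasDerivAt g (f' (x + t • y) y) t := fun t ht =>
    (hf _ (add_smul_mem_eball ht)).comp_hasDerivAt t
      (by simpa using ((hasDerivAt_id t).smul_const y).const_add x)
  have h1 : (1 : ℂ) ∈ Metric.eball (0 : ℂ) (r / ‖y‖ₑ) := by
    rw [mem_eball_zero_iff] at hy
    rw [mem_eball_zero_iff, enorm_one, ENNReal.lt_div_iff_mul_lt (by simp) (by simp)]
    rwa [one_mul]
  have hcoeff (n : ℕ) : iteratedDeriv (n + 1) g 0 = (n.factorial : ℂ) • p n (fun _ => y) y := by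
    have hderiv : deriv g =ᶠ[𝓝 0] fun t => f' (x + t • y) y := by
      filter_upwards [Metric.eball_mem_nhds 0 (pos_of_gt h1)] with t ht using (hg t ht).deriv
    rw [iteratedDeriv_succ', hderiv.iteratedDeriv_eq, iteratedDeriv_comp_line hf']
  have hsum := (hasSum_nat_add_iff' 1).2 <| Complex.hasSum_taylorSeries_on_eball
    (fun t ht => (hg t ht).differentiableAt.differentiableWithinAt) h1
  convert! hsum using 1
  · ext n
    rw [hcoeff, Nat.factorial_succ, sub_zero, one_pow, one_smul, smul_smul]
    congr 1
    have := n.factorial_ne_zero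
    push_cast
    field_simp
  · simp [g]

theorem analyticAt_of_eventually_hasFDerivAt [CompleteSpace F] (hf' : AnalyticAt ℂ f' x)
    (hf : ∀ᶠ y in 𝓝 x, HasFDerivAt f (f' y) y) : AnalyticAt ℂ f x := by
  obtain ⟨p, r₀, hp⟩ := hf'
  obtain ⟨r₁, hr₁, hball⟩ := EMetric.mem_nhds_iff.1 hf
  have hpr := hp.mono (lt_min hp.r_pos hr₁) (min_le_left r₀ r₁)
  let q : FormalMultilinearSeries ℂ E (E →L[ℂ] F) := fun n => (n + 1 : ℂ)⁻¹ • p n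
  have hpq : p.radius ≤ q.radius := FormalMultilinearSeries.radius_le_of_le fun n => by
    rw [norm_smul]
    refine mul_le_of_le_one_left (norm_nonneg _) ?_
    rw [norm_inv]
    refine inv_le_one_of_one_le₀ ?_
    rw [← Nat.cast_succ, Complex.norm_natCast]
    simp
  refine ⟨q.unshift (f x), min r₀ r₁, ?_, hpr.r_pos, fun {y} hy => ?_⟩
  · rw [FormalMultilinearSeries.radius_unshift]
    exact hpr.r_le.trans hpq
  · have hsum := hasSum_sub_of_hasFDerivAt hpr
      (fun z hz => hball (Metric.eball_subset_eball (min_le_right r₀ r₁) hz)) hy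
    refine (hasSum_nat_add_iff' 1).1 ?_
    simpa [FormalMultilinearSeries.unshift, q, Function.comp_def, Fin.init_def] using hsum

end Primitive

section Frame

open VectorField Filter

variable {E : Type*} [NormedAddCommGroup E] [NormedSpace ℂ E]
  {F : Type*} [NormedAddCommGroup F] [NormedSpace ℂ F]
  {𝔤 : Type*} [LieRing 𝔤] [LieAlgebra ℂ 𝔤]

/-- A germ at `y₀` of a holomorphic frame, indexed by the vector space `E`, whose brackets are
those of the Lie algebra `𝔤` under the identification `κ`. -/
structure IsLieFrameAt (κ : E ≃ₗ[ℂ] 𝔤) (V : E → E →L[ℂ] E) (y₀ : E) : Prop where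
  contDiffAt : ContDiffAt ℂ ω V y₀
  isInvertible : ∀ᶠ y in 𝓝 y₀, (V y).IsInvertible
  lie : ∀ᶠ y in 𝓝 y₀, ∀ a b,
    lieBracket ℂ (fun z => V z a) (fun z => V z b) y = V y (κ.symm ⁅κ a, κ b⁆)

/-- The covariant derivative of a function `f`, expressed in the frame `V`, for the connection whose
matrix in this frame is the constant `R`. -/
noncomputable def covDeriv (V : E → E →L[ℂ] E) (R : E →L[ℂ] F →L[ℂ] F) (f : E → F) (y : E) :
    E →L[ℂ] F :=
  (fderiv ℂ f y).comp (V y) + R.flip (f y)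

/-- The exterior covariant derivative of the one-form `θ`, expressed in a Lie frame `V`, vanishes
at `y`. -/
def IsClosedAt (κ : E ≃ₗ[ℂ] 𝔤) (V : E → E →L[ℂ] E) (R : E →L[ℂ] F →L[ℂ] F)
    (θ : E → E →L[ℂ] F) (y : E) : Prop :=
  ∀ a b, covDeriv V R (fun z => θ z b) y a - covDeriv V R (fun z => θ z a) y b
    = θ y (κ.symm ⁅κ a, κ b⁆)

/-- The connection with matrix `R` in a Lie frame is flat: `R` is a representation of `𝔤`. -/
def IsFlatConnection (κ : E ≃ₗ[ℂ] 𝔤) (R : E →L[ℂ] F →L[ℂ] F) : Prop :=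
  ∀ a b, R (κ.symm ⁅κ a, κ b⁆) = ⁅R a, R b⁆

variable {κ : E ≃ₗ[ℂ] 𝔤} {V : E → E →L[ℂ] E} {R : E →L[ℂ] F →L[ℂ] F} {y y₀ : E}
  {f f₁ f₂ : E → F} {θ θ₁ θ₂ : E → E →L[ℂ] F}

theorem covDeriv_apply (a : E) : covDeriv V R f y a = fderiv ℂ f y (V y a) + R a (f y) := rfl

theorem covDeriv_congr (h : f₁ =ᶠ[𝓝 y] f₂) : covDeriv V R f₁ y = covDeriv V R f₂ y := by
  rw [covDeriv, covDeriv, h.fderiv_eq, h.eq_of_nhds]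

theorem covDeriv_add (hf₁ : DifferentiableAt ℂ f₁ y) (hf₂ : DifferentiableAt ℂ f₂ y) :
    covDeriv V R (fun z => f₁ z + f₂ z) y = covDeriv V R f₁ y + covDeriv V R f₂ y := by
  ext a
  simp only [covDeriv_apply, fderiv_fun_add hf₁ hf₂, map_add, add_apply]
  abel

theorem covDeriv_sub (hf₁ : DifferentiableAt ℂ f₁ y) (hf₂ : DifferentiableAt ℂ f₂ y) :
    covDeriv V R (fun z => f₁ z - f₂ z) y = covDeriv V R f₁ y - covDeriv V R f₂ y := by
  ext a
  simp only [covDeriv_apply, fderiv_fun_sub hf₁ hf₂, map_sub, sub_apply]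
  abel

theorem covDeriv_const (w : F) : covDeriv V R (fun _ => w) y = R.flip w := by
  ext a
  simp [covDeriv_apply]

theorem covDeriv_smul {g : E → ℂ} (hg : DifferentiableAt ℂ g y) (hf : DifferentiableAt ℂ f y) :
    covDeriv V R (fun z => g z • f z) y
      = g y • covDeriv V R f y + (covDeriv V 0 g y).smulRight (f y) := by
  ext a
  simp [covDeriv_apply, fderiv_fun_smul hg hf]
  abel

theorem map_covDeriv {l : F →L[ℂ] ℂ} {χ : E →L[ℂ] ℂ} (hf : DifferentiableAt ℂ f y)
    (hl : ∀ a, l (R a (f y)) = χ a * l (f y)) :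
    l.comp (covDeriv V R f y) = covDeriv V (χ.smulRight (.id ℂ ℂ)) (fun z => l (f z)) y := by
  ext a
  simp [covDeriv_apply, (l.hasFDerivAt.comp y hf.hasFDerivAt).fderiv, hl, ← Function.comp_def l f]

theorem contDiffAt_covDeriv (hV : ContDiffAt ℂ ω V y) (hf : ContDiffAt ℂ ω f y) :
    ContDiffAt ℂ ω (covDeriv V R f) y :=
  ((hf.fderiv_right le_top).clm_comp hV).add (R.flip.contDiff.contDiffAt.comp y hf)

theorem IsClosedAt.congr (hθ₁ : IsClosedAt κ V R θ₁ y) (h : θ₁ =ᶠ[𝓝 y] θ₂) :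
    IsClosedAt κ V R θ₂ y := by
  have hcongr (c : E) :
      covDeriv V R (fun z => θ₁ z c) y = covDeriv V R (fun z => θ₂ z c) y :=
    covDeriv_congr <| h.mono fun z hz => congrArg (· c) hz
  intro a b
  rw [← hcongr, ← hcongr, hθ₁, h.eq_of_nhds]

theorem IsClosedAt.sub (h₁ : IsClosedAt κ V R θ₁ y) (h₂ : IsClosedAt κ V R θ₂ y)
    (hθ₁ : DifferentiableAt ℂ θ₁ y) (hθ₂ : DifferentiableAt ℂ θ₂ y) :
    IsClosedAt κ V R (fun z => θ₁ z - θ₂ z) y := by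
  intro a b
  have hsub (c : E) : covDeriv V R (fun z => (θ₁ z - θ₂ z) c) y
      = covDeriv V R (fun z => θ₁ z c) y - covDeriv V R (fun z => θ₂ z c) y :=
    covDeriv_sub (hθ₁.clm_apply (differentiableAt_const c))
      (hθ₂.clm_apply (differentiableAt_const c))
  rw [hsub, hsub, sub_apply, sub_apply, sub_apply, ← h₁, ← h₂]
  abel

theorem fderiv_clm_apply_const (hθ : DifferentiableAt ℂ θ y) (v b : E) :
    fderiv ℂ (fun z => θ z b) y v = fderiv ℂ θ y v b := by
  simp [fderiv_clm_apply hθ (differentiableAt_const b)]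

namespace IsLieFrameAt

theorem eventually (hV : IsLieFrameAt κ V y₀) : ∀ᶠ y in 𝓝 y₀, IsLieFrameAt κ V y := by
  filter_upwards [hV.contDiffAt.eventually (by simp), hV.isInvertible.eventually_nhds,
    hV.lie.eventually_nhds] with y h₁ h₂ h₃ using ⟨h₁, h₂, h₃⟩

theorem differentiableAt (hV : IsLieFrameAt κ V y) : DifferentiableAt ℂ V y :=
  hV.contDiffAt.differentiableAt (by simp)

theorem fderiv_sub_fderiv (hV : IsLieFrameAt κ V y) (a b : E) :
    fderiv ℂ V y (V y a) b - fderiv ℂ V y (V y b) a = V y (κ.symm ⁅κ a, κ b⁆) := by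
  rw [← hV.lie.self_of_nhds, lieBracket, fderiv_clm_apply_const hV.differentiableAt,
    fderiv_clm_apply_const hV.differentiableAt]

theorem isClosedAt_covDeriv (hV : IsLieFrameAt κ V y) (hR : IsFlatConnection κ R)
    (hf : ContDiffAt ℂ ω f y) : IsClosedAt κ V R (covDeriv V R f) y := by
  have hf' : DifferentiableAt ℂ (fderiv ℂ f) y :=
    (hf.fderiv_right (m := 1) le_top).differentiableAt one_ne_zero
  have hfy : DifferentiableAt ℂ f y := hf.differentiableAt (by simp)
  have hderiv (a b : E) : covDeriv V R (fun z => covDeriv V R f z b) y a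
      = fderiv ℂ (fderiv ℂ f) y (V y a) (V y b) + fderiv ℂ f y (fderiv ℂ V y (V y a) b)
        + R b (fderiv ℂ f y (V y a)) + R a (fderiv ℂ f y (V y b) + R b (f y)) := by
    have hVb := hV.differentiableAt.clm_apply (differentiableAt_const b)
    have hRf : HasFDerivAt (fun z => R b (f z)) ((R b).comp (fderiv ℂ f y)) y :=
      (R b).hasFDerivAt.comp y hfy.hasFDerivAt
    simp only [covDeriv_apply]
    rw [((hf'.clm_apply hVb).hasFDerivAt.fun_add hRf).fderiv, fderiv_clm_apply hf' hVb]
    simp only [add_apply, ContinuousLinearMap.comp_apply, ContinuousLinearMap.flip_apply,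
      fderiv_clm_apply_const hV.differentiableAt]
    abel
  intro a b
  rw [hderiv, hderiv, hf.isSymmSndFDerivAt (by simp) (V y a) (V y b), covDeriv_apply,
    ← hV.fderiv_sub_fderiv, hR, Ring.lie_def]
  simp only [map_add, map_sub, sub_apply, ContinuousLinearMap.mul_def,
    ContinuousLinearMap.comp_apply]
  abel

theorem contDiffAt_inverse [CompleteSpace E] (hV : IsLieFrameAt κ V y) :
    ContDiffAt ℂ ω (fun z => (V z).inverse) y := by
  obtain ⟨e, he⟩ := hV.isInvertible.self_of_nhds
  exact ContDiffAt.comp y (he ▸ contDiffAt_map_inverse e) hV.contDiffAt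

theorem fderiv_symm_of_isClosedAt {α : E → E →L[ℂ] F} (hV : IsLieFrameAt κ V y)
    (hα : DifferentiableAt ℂ α y) (hclosed : IsClosedAt κ V 0 (fun z => (α z).comp (V z)) y)
    (u v : E) : fderiv ℂ α y u v = fderiv ℂ α y v u := by
  have hderiv (a b : E) : covDeriv V 0 (fun z => (α z).comp (V z) b) y a
      = fderiv ℂ α y (V y a) (V y b) + α y (fderiv ℂ V y (V y a) b) := by
    simp only [covDeriv_apply, ContinuousLinearMap.comp_apply]
    rw [fderiv_clm_apply hα (hV.differentiableAt.clm_apply (differentiableAt_const b))]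
    simp [fderiv_clm_apply_const hV.differentiableAt]
    abel
  obtain ⟨e, he⟩ := hV.isInvertible.self_of_nhds
  have h := hclosed (e.symm u) (e.symm v)
  rw [hderiv, hderiv, ContinuousLinearMap.comp_apply, ← hV.fderiv_sub_fderiv, map_sub,
    add_sub_add_comm, add_eq_right, sub_eq_zero] at h
  simpa [← he] using h

theorem exists_primitive [CompleteSpace E] [CompleteSpace F] (hV : IsLieFrameAt κ V y₀)
    (hθ : ContDiffAt ℂ ω θ y₀) (hclosed : ∀ᶠ y in 𝓝 y₀, IsClosedAt κ V 0 θ y) :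
    ∃ h : E → F, ContDiffAt ℂ ω h y₀ ∧ h y₀ = 0 ∧ ∀ᶠ y in 𝓝 y₀, covDeriv V 0 h y = θ y := by
  let α : E → E →L[ℂ] F := fun y => (θ y).comp (V y).inverse
  have hα : ContDiffAt ℂ ω α y₀ := hθ.clm_comp hV.contDiffAt_inverse
  have hαV : ∀ᶠ y in 𝓝 y₀, (α y).comp (V y) = θ y := by
    filter_upwards [hV.isInvertible] with y hy
    obtain ⟨e, he⟩ := hy
    ext a
    simp [α, ← he]
  have hαs : ∀ᶠ y in 𝓝 y₀, DifferentiableAt ℂ α y ∧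
      ∀ u v, fderiv ℂ α y u v = fderiv ℂ α y v u := by
    filter_upwards [hα.eventually (by simp), hV.eventually, hαV.eventually_nhds, hclosed]
      with y hα hV hαV hclosed
    have hd := hα.differentiableAt (by simp)
    exact ⟨hd, hV.fderiv_symm_of_isClosedAt hd (hclosed.congr <| EventuallyEq.symm hαV)⟩
  obtain ⟨ε, hε, hball⟩ := Metric.eventually_nhds_iff_ball.1 hαs
  obtain ⟨f, hf⟩ : ∃ f, ∀ y ∈ Metric.ball y₀ ε, HasFDerivAt f (α y) y := by
    refine (convex_ball y₀ ε).exists_forall_hasFDerivAt_of_fderiv_symmetric Metric.isOpen_ball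
      (fun y hy => ((hball y hy).1.restrictScalars ℝ).differentiableWithinAt) fun y hy u v => ?_
    rw [(hball y hy).1.fderiv_restrictScalars ℝ]
    exact (hball y hy).2 u v
  have hf₀ : ∀ᶠ y in 𝓝 y₀, HasFDerivAt f (α y) y :=
    Filter.eventually_of_mem (Metric.ball_mem_nhds y₀ hε) hf
  refine ⟨fun y => f y - f y₀, ?_, sub_self _, ?_⟩
  · exact (analyticAt_of_eventually_hasFDerivAt hα.analyticAt hf₀).contDiffAt.sub contDiffAt_const
  · filter_upwards [hf₀, hαV] with y hf hαV
    rw [← hαV]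
    ext a
    simp [covDeriv_apply, (hf.sub_const _).fderiv]

end IsLieFrameAt

end Frame

section Solvable

open Filter

variable {𝔤 : Type*} [LieRing 𝔤] [LieAlgebra ℂ 𝔤]

theorem exists_eigenfunctional [LieAlgebra.IsSolvable 𝔤] (S : Type*) [AddCommGroup S] [Module ℂ S]
    [FiniteDimensional ℂ S] [Nontrivial S] [LieRingModule 𝔤 S] [LieModule ℂ 𝔤 S] :
    ∃ (l : S →ₗ[ℂ] ℂ) (χ : 𝔤 →ₗ[ℂ] ℂ), l ≠ 0 ∧ ∀ (x : 𝔤) (w : S), l ⁅x, w⁆ = χ x * l w := by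
  obtain ⟨χ, hχ⟩ := LieModule.exists_nontrivial_weightSpace_of_isSolvable ℂ 𝔤 (Module.Dual ℂ S)
  obtain ⟨⟨l, hl⟩, hne⟩ := exists_ne (0 : LieModule.weightSpace (Module.Dual ℂ S) χ)
  refine ⟨l, -χ, fun h => hne (Subtype.ext h), fun x w => ?_⟩
  have h := LinearMap.congr_fun ((LieModule.mem_weightSpace χ l).1 hl x) w
  rw [Module.Dual.lie_apply, LinearMap.smul_apply, smul_eq_mul] at h
  rw [LinearMap.neg_apply, neg_mul, ← h, neg_neg]

variable {E : Type*} [NormedAddCommGroup E] [NormedSpace ℂ E]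
  {F : Type*} [NormedAddCommGroup F] [NormedSpace ℂ F]
  {κ : E ≃ₗ[ℂ] 𝔤} {V : E → E →L[ℂ] E} {R : E →L[ℂ] F →L[ℂ] F} {y₀ : E}

namespace IsFlatConnection

/-- The Lie module structure that a representation induces on an invariant subspace. -/
noncomputable abbrev lieRingModule (hR : IsFlatConnection κ R) {S : Submodule ℂ F}
    (hRS : ∀ a, ∀ w ∈ S, R a w ∈ S) : LieRingModule 𝔤 S where
  bracket x w := ⟨R (κ.symm x) w, hRS _ w w.2⟩
  add_lie x y w := Subtype.ext (by simp)
  lie_add x w w' := Subtype.ext (map_add (R (κ.symm x)) w.1 w'.1)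
  leibniz_lie x y w := Subtype.ext <| by
    have h := congrArg (· (w : F)) (hR (κ.symm x) (κ.symm y))
    rw [κ.apply_symm_apply, κ.apply_symm_apply] at h
    simp only [Ring.lie_def, sub_apply, ContinuousLinearMap.mul_def,
      ContinuousLinearMap.comp_apply] at h
    exact sub_eq_iff_eq_add.1 h.symm

theorem lieModule (hR : IsFlatConnection κ R) {S : Submodule ℂ F}
    (hRS : ∀ a, ∀ w ∈ S, R a w ∈ S) :
    letI := hR.lieRingModule hRS
    LieModule ℂ 𝔤 S :=
  letI := hR.lieRingModule hRS
  { smul_lie c x w := Subtype.ext <| by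
      change R (κ.symm (c • x)) w = c • R (κ.symm x) w
      simp
    lie_smul c x w := Subtype.ext (map_smul (R (κ.symm x)) c w.1) }

theorem exists_eigenfunctional [LieAlgebra.IsSolvable 𝔤] [FiniteDimensional ℂ E]
    [FiniteDimensional ℂ F] (hR : IsFlatConnection κ R)
    {S : Submodule ℂ F} (hRS : ∀ a, ∀ w ∈ S, R a w ∈ S) (hS : S ≠ ⊥) :
    ∃ (l : F →L[ℂ] ℂ) (χ : E →L[ℂ] ℂ), (∃ w ∈ S, l w = 1) ∧
      (∀ a, ∀ w ∈ S, l (R a w) = χ a * l w) ∧ ∀ a b, χ (κ.symm ⁅κ a, κ b⁆) = 0 := by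
  let := hR.lieRingModule hRS
  have := hR.lieModule hRS
  have : Nontrivial S := Submodule.nontrivial_iff_ne_bot.2 hS
  obtain ⟨l₀, χ₀, hl₀, hl⟩ := _root_.exists_eigenfunctional (𝔤 := 𝔤) S
  obtain ⟨w, hw⟩ : ∃ w, l₀ w ≠ 0 := not_forall.1 fun h => hl₀ (LinearMap.ext h)
  obtain ⟨l, hl₁⟩ := LinearMap.exists_extend ((l₀ w)⁻¹ • l₀)
  have hl₂ (v : F) (hv : v ∈ S) : l v = (l₀ w)⁻¹ * l₀ ⟨v, hv⟩ := LinearMap.congr_fun hl₁ ⟨v, hv⟩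
  let χ : E →ₗ[ℂ] ℂ := χ₀ ∘ₗ κ.toLinearMap
  have hlw : l w = 1 := by rw [hl₂ w w.2, inv_mul_cancel₀ hw]
  have heig (a : E) (v : F) (hv : v ∈ S) : l (R a v) = χ a * l v := by
    have h : l₀ ⟨R a v, hRS a v hv⟩ = χ a * l₀ ⟨v, hv⟩ := by
      refine .trans (congrArg l₀ (Subtype.ext ?_)) (hl (κ a) ⟨v, hv⟩)
      change R a v = R (κ.symm (κ a)) v
      rw [κ.symm_apply_apply]
    rw [hl₂ _ (hRS a v hv), hl₂ v hv, h, mul_left_comm]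
  refine ⟨LinearMap.toContinuousLinearMap l, LinearMap.toContinuousLinearMap χ,
    ⟨w, w.2, hlw⟩, heig, fun a b => ?_⟩
  have h := heig (κ.symm ⁅κ a, κ b⁆) w w.2
  rw [hR, Ring.lie_def, hlw, mul_one, sub_apply, map_sub, ContinuousLinearMap.mul_def,
    ContinuousLinearMap.mul_def, ContinuousLinearMap.comp_apply, ContinuousLinearMap.comp_apply,
    heig _ _ (hRS _ _ w.2), heig _ _ (hRS _ _ w.2), heig _ _ w.2, heig _ _ w.2, mul_left_comm,
    sub_self] at h
  exact h.symm

end IsFlatConnection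

theorem covDeriv_exp_mul {V : E → E →L[ℂ] E} {χ : E →L[ℂ] ℂ} {g f : E → ℂ} {y : E}
    (hg : DifferentiableAt ℂ g y) (hf : DifferentiableAt ℂ f y) (hgχ : covDeriv V 0 g y = χ) :
    covDeriv V 0 (fun z => Complex.exp (g z) * f z) y
      = Complex.exp (g y) • covDeriv V (χ.smulRight (.id ℂ ℂ)) f y := by
  have hexp : HasFDerivAt (fun z => Complex.exp (g z) * f z) _ y :=
    hg.hasFDerivAt.cexp.fun_mul hf.hasFDerivAt
  ext a
  have hgχa : fderiv ℂ g y (V y a) = χ a := by simpa [covDeriv_apply] using congrArg (· a) hgχ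
  simp [covDeriv_apply, hexp.fderiv, hgχa]
  ring

theorem IsClosedAt.comp_eigenfunctional {V : E → E →L[ℂ] E} {θ : E → E →L[ℂ] F} {y : E}
    {l : F →L[ℂ] ℂ} {χ : E →L[ℂ] ℂ} (hclosed : IsClosedAt κ V R θ y)
    (hθ : DifferentiableAt ℂ θ y) (hl : ∀ a b, l (R a (θ y b)) = χ a * l (θ y b)) :
    IsClosedAt κ V (χ.smulRight (.id ℂ ℂ)) (fun z => l.comp (θ z)) y := by
  intro a b
  have hmap (c : E) := map_covDeriv (V := V) (hθ.clm_apply (differentiableAt_const c))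
    fun a => hl a c
  simp only [ContinuousLinearMap.comp_apply, ← hmap, ← map_sub, hclosed a b]

theorem covDeriv_smul_const_mem {V : E → E →L[ℂ] E} {S : Submodule ℂ F} {g : E → ℂ} {y : E}
    {w : F} (hg : DifferentiableAt ℂ g y) (hw : w ∈ S) (hRw : ∀ a, R a w ∈ S) (a : E) :
    covDeriv V R (fun z => g z • w) y a ∈ S := by
  simp only [covDeriv_smul hg (differentiableAt_const w), covDeriv_const]
  exact S.add_mem (S.smul_mem _ (hRw a)) (S.smul_mem _ hw)

namespace IsLieFrameAt

theorem exists_primitive_of_character [CompleteSpace E] (hV : IsLieFrameAt κ V y₀) {χ : E →L[ℂ] ℂ}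
    (hχ : ∀ a b, χ (κ.symm ⁅κ a, κ b⁆) = 0) {θ : E → E →L[ℂ] ℂ} (hθ : ContDiffAt ℂ ω θ y₀)
    (hclosed : ∀ᶠ y in 𝓝 y₀, IsClosedAt κ V (χ.smulRight (.id ℂ ℂ)) θ y) :
    ∃ h : E → ℂ, ContDiffAt ℂ ω h y₀ ∧ h y₀ = 0 ∧
      ∀ᶠ y in 𝓝 y₀, covDeriv V (χ.smulRight (.id ℂ ℂ)) h y = θ y := by
  -- If `g` is a primitive of `χ`, multiplying by `exp g` reduces to the trivial character.
  obtain ⟨g, hg, -, hgχ⟩ := hV.exists_primitive (θ := fun _ => χ) contDiffAt_const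
    (.of_forall fun y a b => by simp [covDeriv_apply, hχ])
  obtain ⟨k, hk, hk₀, hkθ⟩ := hV.exists_primitive (θ := fun y => Complex.exp (g y) • θ y)
    (hg.cexp.smul hθ) <| by
      filter_upwards [hclosed, hgχ, hg.eventually (by simp), hθ.eventually (by simp)]
        with y hclosed hgχ hg hθ a b
      have hcov (c : E) := covDeriv_exp_mul (hg.differentiableAt (by simp))
        ((hθ.differentiableAt (by simp)).clm_apply (differentiableAt_const c)) hgχ
      simp only [smul_apply, smul_eq_mul, hcov, ← mul_sub, hclosed a b]
  have hh : ContDiffAt ℂ ω (fun y => Complex.exp (-g y) * k y) y₀ := hg.neg.cexp.mul hk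
  refine ⟨_, hh, by simp [hk₀], ?_⟩
  filter_upwards [hgχ, hkθ, hg.eventually (by simp), hh.eventually (by simp)] with y hgχ hkθ hg hh
  have hcov := covDeriv_exp_mul (hg.differentiableAt (by simp)) (hh.differentiableAt (by simp)) hgχ
  simp only [← mul_assoc, ← Complex.exp_add, add_neg_cancel, Complex.exp_zero, one_mul] at hcov
  exact smul_right_injective _ (Complex.exp_ne_zero _) (hcov.symm.trans hkθ)

theorem exists_primitive_mem [LieAlgebra.IsSolvable 𝔤] [FiniteDimensional ℂ E]
    [FiniteDimensional ℂ F] (hV : IsLieFrameAt κ V y₀) (hR : IsFlatConnection κ R)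
    (S : Submodule ℂ F) (hRS : ∀ a, ∀ w ∈ S, R a w ∈ S) {θ : E → E →L[ℂ] F}
    (hθ : ContDiffAt ℂ ω θ y₀) (hclosed : ∀ᶠ y in 𝓝 y₀, IsClosedAt κ V R θ y)
    (hθS : ∀ᶠ y in 𝓝 y₀, ∀ a, θ y a ∈ S) :
    ∃ Ξ : E → F, ContDiffAt ℂ ω Ξ y₀ ∧ Ξ y₀ = 0 ∧ ∀ᶠ y in 𝓝 y₀, covDeriv V R Ξ y = θ y := by
  have : CompleteSpace E := FiniteDimensional.complete ℂ E
  induction S using WellFoundedLT.induction generalizing θ with | _ S ih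
  obtain rfl | hS := eq_or_ne S ⊥
  · refine ⟨fun _ => 0, contDiffAt_const, rfl, ?_⟩
    filter_upwards [hθS] with y hy
    ext a
    simp [covDeriv_const, (Submodule.mem_bot ℂ).1 (hy a)]
  obtain ⟨l, χ, ⟨w, hwS, hlw⟩, hl, hχ⟩ := hR.exists_eigenfunctional hRS hS
  obtain ⟨h, hh, hh₀, hhθ⟩ := hV.exists_primitive_of_character hχ
    (θ := fun y => l.comp (θ y)) (contDiffAt_const.clm_comp hθ) <| by
      filter_upwards [hclosed, hθS, hθ.eventually (by simp)] with y hclosed hθS hθ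
      exact hclosed.comp_eigenfunctional (hθ.differentiableAt (by simp)) fun a b => hl a _ (hθS b)
  have hhw : ContDiffAt ℂ ω (fun y => h y • w) y₀ := hh.smul contDiffAt_const
  -- Once the `l`-component is integrated, the remainder is valued in `S ⊓ ker l`.
  let θ' : E → E →L[ℂ] F := fun y => θ y - covDeriv V R (fun z => h z • w) y
  have hclosed' : ∀ᶠ y in 𝓝 y₀, IsClosedAt κ V R θ' y := by
    filter_upwards [hclosed, hV.eventually, hθ.eventually (by simp), hhw.eventually (by simp)]
      with y hclosed hV hθ hhw
    exact hclosed.sub (hV.isClosedAt_covDeriv hR hhw) (hθ.differentiableAt (by simp))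
      ((contDiffAt_covDeriv hV.contDiffAt hhw).differentiableAt (by simp))
  have hθ'S : ∀ᶠ y in 𝓝 y₀, ∀ a, θ' y a ∈ S ⊓ LinearMap.ker l.toLinearMap := by
    filter_upwards [hθS, hhθ, hh.eventually (by simp), hhw.eventually (by simp)]
      with y hθS hhθ hh hhw a
    have hmap := map_covDeriv (V := V) (R := R) (hhw.differentiableAt (by simp))
      fun a => hl a _ (S.smul_mem _ hwS)
    simp only [map_smul, hlw, smul_eq_mul, mul_one, hhθ] at hmap
    exact ⟨S.sub_mem (hθS a)
        (covDeriv_smul_const_mem (hh.differentiableAt (by simp)) hwS (hRS · w hwS) a),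
      (map_sub l _ _).trans (sub_eq_zero.2 (congrArg (· a) hmap).symm)⟩
  obtain ⟨Ξ, hΞ, hΞ₀, hΞθ⟩ := ih _
    (inf_lt_left.2 fun hle => one_ne_zero (hlw.symm.trans (hle hwS)))
    (fun a v hv => ⟨hRS a v hv.1, (hl a v hv.1).trans (mul_eq_zero_of_right _ hv.2)⟩)
    (hθ.sub (contDiffAt_covDeriv hV.contDiffAt hhw)) hclosed' hθ'S
  refine ⟨fun y => Ξ y + h y • w, hΞ.add hhw, by simp [hΞ₀, hh₀], ?_⟩
  filter_upwards [hΞθ, hΞ.eventually (by simp), hhw.eventually (by simp)] with y hΞθ hΞ hhw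
  rw [covDeriv_add (hΞ.differentiableAt (by simp)) (hhw.differentiableAt (by simp)), hΞθ,
    sub_add_cancel]

theorem exists_parallel [LieAlgebra.IsSolvable 𝔤] [FiniteDimensional ℂ E]
    [FiniteDimensional ℂ F] (hV : IsLieFrameAt κ V y₀) (hR : IsFlatConnection κ R) (w : F) :
    ∃ Ξ : E → F, ContDiffAt ℂ ω Ξ y₀ ∧ Ξ y₀ = w ∧ ∀ᶠ y in 𝓝 y₀, covDeriv V R Ξ y = 0 := by
  obtain ⟨Ξ, hΞ, hΞ₀, hΞw⟩ := hV.exists_primitive_mem hR ⊤ (fun _ _ _ => trivial)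
    (θ := covDeriv V R fun _ => w) (contDiffAt_covDeriv hV.contDiffAt contDiffAt_const)
    (hV.eventually.mono fun y hV => hV.isClosedAt_covDeriv hR contDiffAt_const)
    (.of_forall fun _ _ => trivial)
  refine ⟨fun y => w - Ξ y, contDiffAt_const.sub hΞ, by simp [hΞ₀], ?_⟩
  filter_upwards [hΞw, hΞ.eventually (by simp)] with y hΞw hΞ
  rw [covDeriv_sub (differentiableAt_const w) (hΞ.differentiableAt (by simp)), hΞw, sub_self]

theorem exists_parallel_frame [LieAlgebra.IsSolvable 𝔤] [FiniteDimensional ℂ E]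
    [FiniteDimensional ℂ F] (hV : IsLieFrameAt κ V y₀) (hR : IsFlatConnection κ R) :
    ∃ Φ : E → F →L[ℂ] F, ContDiffAt ℂ ω Φ y₀ ∧ Φ y₀ = .id ℂ F ∧
      ∀ᶠ y in 𝓝 y₀, ∀ w, covDeriv V R (fun z => Φ z w) y = 0 := by
  let b := Module.finBasis ℂ F
  choose Ξ hΞ hΞ₀ hΞcov using fun i => hV.exists_parallel hR (b i)
  let c (i) : F →L[ℂ] ℂ := LinearMap.toContinuousLinearMap (b.coord i)
  refine ⟨fun y => ∑ i, (c i).smulRight (Ξ i y), ?_, ?_, ?_⟩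
  · exact ContDiffAt.sum fun i _ => contDiffAt_const.smulRight (hΞ i)
  · ext w
    simp [c, hΞ₀, b.sum_repr]
  · filter_upwards [Filter.eventually_all.2 hΞcov,
      Filter.eventually_all.2 fun i => (hΞ i).eventually (by simp)] with y hcov hd w
    have hsum : HasFDerivAt (fun z => ∑ i, c i w • Ξ i z) (∑ i, c i w • fderiv ℂ (Ξ i) y) y :=
      .fun_sum fun i _ => (((hd i).differentiableAt (by simp)).hasFDerivAt).fun_const_smul _
    ext a
    have hcova (i) : fderiv ℂ (Ξ i) y (V y a) = -R a (Ξ i y) :=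
      eq_neg_of_add_eq_zero_left (congrArg (· a) (hcov i))
    simp [covDeriv_apply, hsum.fderiv, hcova]

end IsLieFrameAt

end Solvable

/-! ### Symmetry germs from twisted derivations -/

section LieGroupFrame

open VectorField Bundle

section

variable {𝕜 : Type*} [NontriviallyNormedField 𝕜] {H : Type*} [TopologicalSpace H]
  {E : Type*} [NormedAddCommGroup E] [NormedSpace 𝕜 E] {I : ModelWithCorners 𝕜 E H}
  {G : Type*} [TopologicalSpace G] [ChartedSpace H G] [Group G]

/- Mathlib's `contMDiff_mulInvariantVectorField` stops at `C²` over `ℂ`; the same argument gives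
analyticity. -/
theorem contMDiff_omega_mulInvariantVectorField [LieGroup I ω G] (v : GroupLieAlgebra I G) :
    ContMDiff I I.tangent ω
      (fun g : G => (⟨g, mulInvariantVectorField v g⟩ : TangentBundle I G)) := by
  have hzero : ContMDiff I I.tangent ω (fun g : G => (TotalSpace.mk' E g 0 : TangentBundle I G)) :=
    contMDiff_zeroSection _ _
  have hconst : ContMDiff I I.tangent ω (fun _ : G => (TotalSpace.mk' E 1 v : TangentBundle I G)) :=
    contMDiff_const
  have hmul : ContMDiff (I.prod I).tangent I.tangent ω
      (tangentMap (I.prod I) I (fun p : G × G => p.1 * p.2)) :=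
    (contMDiff_mul I ω).contMDiff_tangentMap le_rfl
  convert! (hmul.comp contMDiff_equivTangentBundleProd_symm).comp (hzero.prodMk hconst) with g
  · simp
  · simp only [Function.comp_apply, tangentMap]
    rw [mfderiv_prod_eq_add_apply ((contMDiff_mul I ω).mdifferentiableAt (by simp))]
    exact (zero_add _).symm.trans (congrArg₂ (· + ·) (map_zero _).symm rfl)

theorem isInvertible_mfderiv_mul_left {n : WithTop ℕ∞} [LieGroup I n G] (hn : n ≠ 0) (g h : G) :
    (mfderiv I I (fun x : G => g * x) h).IsInvertible := by
  have hd (a x : G) : MDifferentiableAt I I (fun x : G => a * x) x :=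
    (contMDiff_mul_left (n := n)).contMDiffAt.mdifferentiableAt hn
  have hleft : mfderiv I I ((fun x : G => g⁻¹ * x) ∘ (fun x => g * x)) h = .id 𝕜 _ := by
    rw [show (fun x : G => g⁻¹ * x) ∘ (fun x => g * x) = id by ext x; simp, id_eq, mfderiv_id]
  have hright : mfderiv I I ((fun x : G => g * x) ∘ (fun x => g⁻¹ * x)) (g * h) = .id 𝕜 _ := by
    rw [show (fun x : G => g * x) ∘ (fun x => g⁻¹ * x) = id by ext x; simp, id_eq, mfderiv_id]
  rw [mfderiv_comp (I' := I) _ (hd _ _) (hd _ _)] at hleft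
  rw [mfderiv_comp (I' := I) _ (hd _ _) (hd _ _), inv_mul_cancel_left] at hright
  exact .of_inverse hright hleft

end

variable {E : Type*} [NormedAddCommGroup E] [NormedSpace ℂ E]
  {G : Type*} [TopologicalSpace G] [ChartedSpace E G] [Group G]

variable (E G) in
/-- The inverse of the chart at the identity. -/
noncomputable abbrev chartInv : E → G := (extChartAt 𝓘(ℂ, E) (1 : G)).symm

variable (E G) in
/-- The domain of `chartInv`. -/
abbrev chartDomain : Set E := (extChartAt 𝓘(ℂ, E) (1 : G)).target

variable (E G) in
/-- The left-invariant vector fields in the chart at the identity. -/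
noncomputable def chartFrame (y : E) : E →L[ℂ] E :=
  ((mfderiv 𝓘(ℂ, E) 𝓘(ℂ, E) (chartInv E G) y).inverse : E →L[ℂ] E).comp
    (mfderiv 𝓘(ℂ, E) 𝓘(ℂ, E) (fun h : G => chartInv E G y * h) 1 : E →L[ℂ] E)

variable {y : E}

theorem chartDomain_mem_nhds (hy : y ∈ chartDomain E G) : chartDomain E G ∈ 𝓝 y :=
  (isOpen_extChartAt_target 1).mem_nhds hy

theorem eventually_chartInv_iff (hy : y ∈ chartDomain E G) {p : G → Prop} :
    (∀ᶠ z in 𝓝 y, p (chartInv E G z)) ↔ ∀ᶠ q in 𝓝 (chartInv E G y), p q := by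
  have h := map_extChartAt_symm_nhdsWithin_range' (I := 𝓘(ℂ, E))
    ((extChartAt 𝓘(ℂ, E) (1 : G)).map_target hy)
  rw [ModelWithCorners.Boundaryless.range_eq_univ, nhdsWithin_univ,
    (extChartAt 𝓘(ℂ, E) (1 : G)).right_inv hy] at h
  rw [← h, Filter.eventually_map]

variable [LieGroup 𝓘(ℂ, E) ω G]

theorem contMDiffAt_chartInv (hy : y ∈ chartDomain E G) :
    ContMDiffAt 𝓘(ℂ, E) 𝓘(ℂ, E) ω (chartInv E G) y :=
  (contMDiffOn_extChartAt_symm (1 : G)).contMDiffAt (chartDomain_mem_nhds hy)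

theorem isInvertible_mfderiv_chartInv (hy : y ∈ chartDomain E G) :
    (mfderiv 𝓘(ℂ, E) 𝓘(ℂ, E) (chartInv E G) y).IsInvertible := by
  have : IsManifold 𝓘(ℂ, E) 1 G := IsManifold.of_le (n := ω) le_top
  have := isInvertible_mfderivWithin_extChartAt_symm (I := 𝓘(ℂ, E)) hy
  rwa [ModelWithCorners.Boundaryless.range_eq_univ, mfderivWithin_univ] at this

theorem contDiffAt_mpullback_chartInv [CompleteSpace E] {Y : Π x : G, TangentSpace 𝓘(ℂ, E) x}
    (hy : y ∈ chartDomain E G) (hY : HolomorphicVectorFieldAt Y (chartInv E G y)) :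
    ContDiffAt ℂ ω (mpullback 𝓘(ℂ, E) 𝓘(ℂ, E) (chartInv E G) Y : E → E) y := by
  rw [← contMDiffAt_vectorSpace_iff_contDiffAt]
  exact ContMDiffAt.mpullback_vectorField_preimage (n := ω) hY (contMDiffAt_chartInv hy)
    (isInvertible_mfderiv_chartInv hy) le_rfl

theorem mpullback_chartInv_mlieBracket [CompleteSpace E] {X Y : Π x : G, TangentSpace 𝓘(ℂ, E) x}
    (hy : y ∈ chartDomain E G) (hX : HolomorphicVectorFieldAt X (chartInv E G y))
    (hY : HolomorphicVectorFieldAt Y (chartInv E G y)) :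
    mpullback 𝓘(ℂ, E) 𝓘(ℂ, E) (chartInv E G) (mlieBracket 𝓘(ℂ, E) X Y) y =
      lieBracket ℂ (mpullback 𝓘(ℂ, E) 𝓘(ℂ, E) (chartInv E G) X : E → E)
        (mpullback 𝓘(ℂ, E) 𝓘(ℂ, E) (chartInv E G) Y : E → E) y := by
  rw [mpullback_mlieBracket (n := ω) (hX.mdifferentiableAt (by simp))
    (hY.mdifferentiableAt (by simp)) (contMDiffAt_chartInv hy) le_top, ← mlieBracketWithin_univ]
  exact (congrFun (mlieBracketWithin_eq_lieBracketWithin (s := Set.univ)) y).trans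
    (congrFun lieBracketWithin_univ y)

variable {𝔤 : Type*} [LieRing 𝔤] [LieAlgebra ℂ 𝔤]

/-- The identification of the model space with the Lie algebra. -/
noncomputable def modelEquiv [CompleteSpace E] (ι : 𝔤 ≃ₗ⁅ℂ⁆ GroupLieAlgebra 𝓘(ℂ, E) G) :
    E ≃ₗ[ℂ] 𝔤 :=
  (ι.toLinearEquiv.symm : GroupLieAlgebra 𝓘(ℂ, E) G ≃ₗ[ℂ] 𝔤)

theorem isLieFrameAt_chartFrame [FiniteDimensional ℂ E] [CompleteSpace E]
    (ι : 𝔤 ≃ₗ⁅ℂ⁆ GroupLieAlgebra 𝓘(ℂ, E) G) (hy : y ∈ chartDomain E G) :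
    IsLieFrameAt (modelEquiv ι) (chartFrame E G) y where
  contDiffAt := by
    refine (contDiffOn_clm_apply.2 fun a z hz => ?_).contDiffAt (chartDomain_mem_nhds hy)
    let a' : GroupLieAlgebra 𝓘(ℂ, E) G := a
    exact (contDiffAt_mpullback_chartInv hz
      (contMDiff_omega_mulInvariantVectorField a' _)).contDiffWithinAt
  isInvertible := by
    filter_upwards [chartDomain_mem_nhds hy] with z hz
    exact (isInvertible_mfderiv_chartInv hz).inverse.comp
      (isInvertible_mfderiv_mul_left (E := E) (n := ω) (by simp) (chartInv E G z) 1)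
  lie := by
    filter_upwards [chartDomain_mem_nhds hy] with z hz a b
    let a' : GroupLieAlgebra 𝓘(ℂ, E) G := a
    let b' : GroupLieAlgebra 𝓘(ℂ, E) G := b
    have hbracket := mpullback_chartInv_mlieBracket hz
      (contMDiff_omega_mulInvariantVectorField a' _) (contMDiff_omega_mulInvariantVectorField b' _)
    have hι : ι ⁅ι.symm a', ι.symm b'⁆ = ⁅a', b'⁆ := by
      rw [LieEquiv.map_lie, LieEquiv.apply_symm_apply, LieEquiv.apply_symm_apply]
    rw [← mulInvariantVector_mlieBracket, ← GroupLieAlgebra.bracket_def, ← hι] at hbracket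
    exact hbracket.symm

end LieGroupFrame

section TwistedDerivation

variable {𝔤 : Type*} [LieRing 𝔤] [LieAlgebra ℂ 𝔤]

/-- `D` is a derivation of `𝔤` twisted by the character `φ`. Equivalently, the adjoint action of
`𝔤` extends to a representation on `𝔤 ⊕ ℂ` in which `x` sends `1 ∈ ℂ` to `D x + φ x`. -/
structure IsTwistedDerivation (D : 𝔤 →ₗ[ℂ] 𝔤) (φ : 𝔤 →ₗ[ℂ] ℂ) : Prop where
  map_lie : ∀ x y, D ⁅x, y⁆ = ⁅D x, y⁆ + ⁅x, D y⁆ + φ y • D x - φ x • D y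
  char_lie : ∀ x y : 𝔤, φ ⁅x, y⁆ = 0

variable {E : Type*} [NormedAddCommGroup E] [NormedSpace ℂ E] [FiniteDimensional ℂ E]

/-- The representation of `𝔤` on `𝔤 ⊕ ℂ` determined by a twisted derivation `D` with character `φ`,
with `𝔤` replaced by the vector space `E` via `κ`. -/
noncomputable def twistedConnection (κ : E ≃ₗ[ℂ] 𝔤) (D : 𝔤 →ₗ[ℂ] 𝔤) (φ : 𝔤 →ₗ[ℂ] ℂ) :
    E →L[ℂ] E × ℂ →L[ℂ] E × ℂ :=
  LinearMap.toContinuousLinearMap <| LinearMap.toContinuousLinearMap.toLinearMap.comp <|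
    LinearMap.mk₂ ℂ
      (fun v w => (κ.symm (⁅κ v, κ w.1⁆ + w.2 • D (κ v)), w.2 * φ (κ v)))
      (fun _ _ _ => by ext <;> simp [mul_add]; abel)
      (fun c _ w => by ext <;> simp [smul_comm w.2 c, mul_left_comm])
      (fun _ _ _ => by ext <;> simp [add_smul, add_mul]; abel)
      (fun _ _ _ => by ext <;> simp [mul_smul, mul_assoc])

variable {κ : E ≃ₗ[ℂ] 𝔤} {D : 𝔤 →ₗ[ℂ] 𝔤} {φ : 𝔤 →ₗ[ℂ] ℂ}

theorem twistedConnection_apply (v : E) (w : E × ℂ) :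
    twistedConnection κ D φ v w = (κ.symm (⁅κ v, κ w.1⁆ + w.2 • D (κ v)), w.2 * φ (κ v)) :=
  rfl

theorem IsTwistedDerivation.isFlatConnection (h : IsTwistedDerivation D φ) :
    IsFlatConnection κ (twistedConnection κ D φ) := by
  intro a b
  refine ContinuousLinearMap.ext fun w => ?_
  simp only [Ring.lie_def, sub_apply, ContinuousLinearMap.mul_def, ContinuousLinearMap.comp_apply,
    twistedConnection_apply, LinearEquiv.apply_symm_apply, Prod.mk_sub_mk, ← map_sub, h.map_lie,
    h.char_lie]
  congr 2
  · simp only [lie_add, lie_smul, lie_lie, mul_smul, smul_add, smul_sub]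
    rw [← lie_skew (D (κ a)) (κ b), smul_neg]
    abel
  · ring

end TwistedDerivation

section DerivativeInSubspace

variable {𝕜 : Type*} [NontriviallyNormedField 𝕜] [CompleteSpace 𝕜]
  {E : Type*} [NormedAddCommGroup E] [NormedSpace 𝕜 E]
  {F : Type*} [NormedAddCommGroup F] [NormedSpace 𝕜 F] [FiniteDimensional 𝕜 F]

theorem fderiv_apply_mem_of_eventually_mem {b : E → F} {y : E} (hb : DifferentiableAt 𝕜 b y)
    (T : Submodule 𝕜 F) (h : ∀ᶠ z in 𝓝 y, b z ∈ T) (v : E) : fderiv 𝕜 b y v ∈ T := by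
  by_contra hv
  obtain ⟨l, hl, hlT⟩ := Submodule.exists_le_ker_of_notMem hv
  have hcomp := (LinearMap.toContinuousLinearMap l).hasFDerivAt.comp y hb.hasFDerivAt
  have hzero : (fun _ => 0) =ᶠ[𝓝 y] LinearMap.toContinuousLinearMap l ∘ b :=
    h.mono fun z hz => (hlT hz).symm
  have hfderiv := (hcomp.congr_of_eventuallyEq hzero).unique (hasFDerivAt_const (0 : 𝕜) y)
  exact hl (DFunLike.congr_fun hfderiv v)

end DerivativeInSubspace

section FrameField

open VectorField

variable {𝔤 : Type*} [LieRing 𝔤] [LieAlgebra ℂ 𝔤]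
  {E : Type*} [NormedAddCommGroup E] [NormedSpace ℂ E]

theorem IsLieFrameAt.lieBracket_apply {κ : E ≃ₗ[ℂ] 𝔤} {V : E → E →L[ℂ] E} {y : E}
    (hV : IsLieFrameAt κ V y) {a b : E → E} (ha : DifferentiableAt ℂ a y)
    (hb : DifferentiableAt ℂ b y) :
    lieBracket ℂ (fun z => V z (a z)) (fun z => V z (b z)) y =
      V y (κ.symm ⁅κ (a y), κ (b y)⁆ + fderiv ℂ b y (V y (a y)) - fderiv ℂ a y (V y (b y))) := by
  rw [lieBracket, fderiv_clm_apply hV.differentiableAt ha,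
    fderiv_clm_apply hV.differentiableAt hb]
  simp only [map_add, map_sub, ← hV.fderiv_sub_fderiv, add_apply, ContinuousLinearMap.comp_apply,
    ContinuousLinearMap.flip_apply]
  abel

variable {G : Type*} [TopologicalSpace G] [ChartedSpace E G] [Group G]

variable (G) in
/-- The vector field on `G` with components `a` in the left-invariant frame, where `a` is given in
the chart at the identity. -/
noncomputable def frameField : (E → E) →ₗ[ℂ] Π x : G, TangentSpace 𝓘(ℂ, E) x where
  toFun a x :=
    mulInvariantVectorField (a (extChartAt 𝓘(ℂ, E) (1 : G) x) : GroupLieAlgebra 𝓘(ℂ, E) G) x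
  map_add' _ _ := funext fun x => congrFun (mulInvariantVectorField_add _ _) x
  map_smul' _ _ := funext fun x => congrFun (mulInvariantVectorField_smul _ _) x

variable {a b : E → E} {y : E}

theorem frameField_apply (a : E → E) (x : G) : frameField G a x =
    mulInvariantVectorField (a (extChartAt 𝓘(ℂ, E) (1 : G) x) : GroupLieAlgebra 𝓘(ℂ, E) G) x :=
  rfl

theorem frameField_chartInv (a : E → E) (hy : y ∈ chartDomain E G) :
    frameField G a (chartInv E G y) =
      mulInvariantVectorField (a y : GroupLieAlgebra 𝓘(ℂ, E) G) (chartInv E G y) := by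
  rw [frameField_apply, (extChartAt 𝓘(ℂ, E) (1 : G)).right_inv hy]

theorem mpullback_frameField (a : E → E) (hy : y ∈ chartDomain E G) :
    mpullback 𝓘(ℂ, E) 𝓘(ℂ, E) (chartInv E G) (frameField G a) y = chartFrame E G y (a y) := by
  rw [mpullback_apply, frameField_chartInv a hy]
  rfl

variable [LieGroup 𝓘(ℂ, E) ω G]

theorem frameField_apply_eq_zero_iff (a : E → E) (x : G) :
    frameField G a x = 0 ↔ a (extChartAt 𝓘(ℂ, E) (1 : G) x) = 0 := by
  obtain ⟨e, he⟩ := isInvertible_mfderiv_mul_left (I := 𝓘(ℂ, E)) (n := ω) (by simp) x 1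
  change mfderiv 𝓘(ℂ, E) 𝓘(ℂ, E) (fun h : G => x * h) 1 (a _) = 0 ↔ _
  rw [← he]
  exact e.map_eq_zero_iff

variable [FiniteDimensional ℂ E]

theorem holomorphicVectorFieldAt_frameField (hy : y ∈ chartDomain E G)
    (ha : ContDiffAt ℂ ω a y) : HolomorphicVectorFieldAt (frameField G a) (chartInv E G y) := by
  let B := Module.finBasis ℂ E
  let c (i) : E →L[ℂ] ℂ := LinearMap.toContinuousLinearMap (B.coord i)
  let f i (x : G) : ℂ := c i (a (extChartAt 𝓘(ℂ, E) (1 : G) x))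
  let X i : Π x : G, TangentSpace 𝓘(ℂ, E) x :=
    mulInvariantVectorField (B i : GroupLieAlgebra 𝓘(ℂ, E) G)
  have hf (i) : ContMDiffAt 𝓘(ℂ, E) 𝓘(ℂ, ℂ) ω (f i) (chartInv E G y) := by
    rw [← (extChartAt 𝓘(ℂ, E) (1 : G)).right_inv hy] at ha
    refine ((c i).contDiff.contDiffAt.comp _ ha).contMDiffAt.comp _ (contMDiffAt_extChartAt' ?_)
    simpa using (extChartAt 𝓘(ℂ, E) (1 : G)).map_target hy
  have hexpand (x : G) : frameField G a x = ∑ i, f i x • X i x := by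
    let L : E →L[ℂ] E := mfderiv 𝓘(ℂ, E) 𝓘(ℂ, E) (fun h : G => x * h) 1
    change L (a _) = ∑ i, f i x • L (B i)
    conv_lhs => rw [← B.sum_repr (a _), map_sum]
    exact Finset.sum_congr rfl fun i _ => map_smul _ _ _
  have hsum := ContMDiffAt.sum_section (s := Finset.univ) (t := fun i x => f i x • X i x)
    fun i _ => (hf i).smul_section (contMDiff_omega_mulInvariantVectorField
      (B i : GroupLieAlgebra 𝓘(ℂ, E) G) _)
  exact hsum.congr_of_eventuallyEq <| .of_forall fun x => congrArg
    (fun v => (⟨x, v⟩ : TangentBundle 𝓘(ℂ, E) G)) (hexpand x)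

variable [CompleteSpace E]

theorem mlieBracket_frameField (ι : 𝔤 ≃ₗ⁅ℂ⁆ GroupLieAlgebra 𝓘(ℂ, E) G)
    (hy : y ∈ chartDomain E G) (ha : ContDiffAt ℂ ω a y) (hb : ContDiffAt ℂ ω b y) :
    mlieBracket 𝓘(ℂ, E) (frameField G a) (frameField G b) (chartInv E G y) =
      mulInvariantVectorField ((modelEquiv ι).symm ⁅modelEquiv ι (a y), modelEquiv ι (b y)⁆
        + fderiv ℂ b y (chartFrame E G y (a y)) - fderiv ℂ a y (chartFrame E G y (b y)) :
          GroupLieAlgebra 𝓘(ℂ, E) G) (chartInv E G y) := by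
  have hpullback (c : E → E) :
      (mpullback 𝓘(ℂ, E) 𝓘(ℂ, E) (chartInv E G) (frameField G c) : E → E)
        =ᶠ[𝓝 y] fun z => chartFrame E G z (c z) :=
    Filter.eventually_of_mem (chartDomain_mem_nhds hy) fun z hz => mpullback_frameField c hz
  have hbracket := mpullback_chartInv_mlieBracket hy (holomorphicVectorFieldAt_frameField hy ha)
    (holomorphicVectorFieldAt_frameField hy hb)
  rw [(hpullback a).lieBracket_vectorField_eq (hpullback b),
    (isLieFrameAt_chartFrame ι hy).lieBracket_apply (ha.differentiableAt (by simp))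
      (hb.differentiableAt (by simp))] at hbracket
  exact (isInvertible_mfderiv_chartInv hy).inverse.injective hbracket

theorem exists_eventuallyEq_frameField (ι : 𝔤 ≃ₗ⁅ℂ⁆ GroupLieAlgebra 𝓘(ℂ, E) G)
    (hy : y ∈ chartDomain E G) (S : Submodule ℂ 𝔤) {Y : Π x : G, TangentSpace 𝓘(ℂ, E) x}
    (hY : HolomorphicVectorFieldAt Y (chartInv E G y))
    (hYS : ∀ᶠ q in 𝓝 (chartInv E G y),
      Y q ∈ leftInvariantDistribution (S.map ι.toLinearEquiv.toLinearMap) q) :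
    ∃ b : E → E, ContDiffAt ℂ ω b y ∧ (∀ᶠ z in 𝓝 y, modelEquiv ι (b z) ∈ S) ∧
      Y =ᶠ[𝓝 (chartInv E G y)] frameField G b := by
  have hV := isLieFrameAt_chartFrame ι hy
  let b (z : E) : E :=
    (chartFrame E G z).inverse (mpullback 𝓘(ℂ, E) 𝓘(ℂ, E) (chartInv E G) Y z)
  have hb : ∀ᶠ z in 𝓝 y, modelEquiv ι (b z) ∈ S ∧
      Y (chartInv E G z) = frameField G b (chartInv E G z) := by
    filter_upwards [(eventually_chartInv_iff hy).2 hYS, hV.isInvertible, chartDomain_mem_nhds hy]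
      with z hz hinv hzdom
    obtain ⟨_, ⟨s, hs, rfl⟩, hv⟩ := hz
    have hbz : b z = (modelEquiv ι).symm s := by
      change (chartFrame E G z).inverse (mpullback _ _ _ Y z) = _
      rw [mpullback_apply, ← hv]
      exact hinv.inverse_apply_eq.2 rfl
    rw [frameField_chartInv b hzdom, hbz, ← hv, LinearEquiv.apply_symm_apply]
    exact ⟨hs, rfl⟩
  exact ⟨b, hV.contDiffAt_inverse.clm_apply (contDiffAt_mpullback_chartInv hy hY),
    hb.mono fun _ h => h.1, (eventually_chartInv_iff hy).1 (hb.mono fun _ h => h.2)⟩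

theorem preservesDistributionAt_frameField (ι : 𝔤 ≃ₗ⁅ℂ⁆ GroupLieAlgebra 𝓘(ℂ, E) G)
    (hy : y ∈ chartDomain E G) (ha : ContDiffAt ℂ ω a y) (S : Submodule ℂ 𝔤)
    (hS : ∀ b, modelEquiv ι b ∈ S →
      ⁅modelEquiv ι (a y), modelEquiv ι b⁆ - modelEquiv ι (fderiv ℂ a y (chartFrame E G y b)) ∈ S) :
    PreservesDistributionAt (leftInvariantDistribution (S.map ι.toLinearEquiv.toLinearMap))
      (frameField G a) (chartInv E G y) := by
  intro Y hY hYS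
  obtain ⟨b, hb, hbS, hYb⟩ := exists_eventuallyEq_frameField ι hy S hY hYS
  rw [Filter.EventuallyEq.rfl.mlieBracket_vectorField_eq hYb, mlieBracket_frameField ι hy ha hb]
  refine ⟨_, ⟨modelEquiv ι _, ?_, (modelEquiv ι).symm_apply_apply _⟩, rfl⟩
  have hderiv : modelEquiv ι (fderiv ℂ b y (chartFrame E G y (a y))) ∈ S :=
    fderiv_apply_mem_of_eventually_mem (hb.differentiableAt (by simp))
      (S.comap (modelEquiv ι).toLinearMap) hbS _
  rw [map_sub, map_add, LinearEquiv.apply_symm_apply, add_sub_right_comm]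
  exact add_mem (hS (b y) hbS.self_of_nhds) hderiv

end FrameField

section SymmetryGerms

variable {𝔤 : Type*} [LieRing 𝔤] [LieAlgebra ℂ 𝔤]
  {E : Type*} [NormedAddCommGroup E] [NormedSpace ℂ E] [FiniteDimensional ℂ E]
  {D : 𝔤 →ₗ[ℂ] 𝔤} {φ : 𝔤 →ₗ[ℂ] ℂ} {f : E → E × ℂ} {y y₀ : E}

theorem fst_fderiv_of_covDeriv_eq_zero {κ : E ≃ₗ[ℂ] 𝔤} {V : E → E →L[ℂ] E}
    (hf : DifferentiableAt ℂ f y) (hcov : covDeriv V (twistedConnection κ D φ) f y = 0) (b : E) :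
    κ (fderiv ℂ (fun z => (f z).1) y (V y b)) = ⁅κ (f y).1, κ b⁆ - (f y).2 • D (κ b) := by
  have h : κ (fderiv ℂ f y (V y b)).1 + (⁅κ b, κ (f y).1⁆ + (f y).2 • D (κ b)) = 0 := by
    have h := congrArg (fun w => κ w.1) (DFunLike.congr_fun hcov b)
    simpa [covDeriv_apply, twistedConnection_apply] using h
  rw [hf.hasFDerivAt.fst.fderiv, ← lie_skew, ← neg_add']
  exact eq_neg_of_add_eq_zero_left h

theorem eq_zero_of_covDeriv_eq_zero {κ : E ≃ₗ[ℂ] 𝔤} {V : E → E →L[ℂ] E} (hD : D ≠ 0)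
    (hf : DifferentiableAt ℂ f y) (hcov : covDeriv V (twistedConnection κ D φ) f y = 0)
    (hfst : (fun z => (f z).1) =ᶠ[𝓝 y] 0) : f y = 0 := by
  refine Prod.ext hfst.eq_of_nhds (by_contra fun hsnd => hD (LinearMap.ext fun v => ?_))
  have h := fst_fderiv_of_covDeriv_eq_zero hf hcov (κ.symm v)
  rw [hfst.fderiv_eq, hfst.eq_of_nhds] at h
  have h' : (f y).2 • D v = 0 := by simpa using h
  exact (smul_eq_zero.1 h').resolve_left hsnd

variable [CompleteSpace E] {G : Type*} [TopologicalSpace G] [ChartedSpace E G] [Group G]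
  [LieGroup 𝓘(ℂ, E) ω G]

theorem frameField_mem_localSymmetries (ι : 𝔤 ≃ₗ⁅ℂ⁆ GroupLieAlgebra 𝓘(ℂ, E) G)
    {S T : Submodule ℂ 𝔤} (hS : ∀ x ∈ S, D x ∈ S) (hT : ∀ x ∈ T, D x ∈ T)
    (hy : y ∈ chartDomain E G) (hf : ContDiffAt ℂ ω f y)
    (hcov : ∀ᶠ z in 𝓝 y,
      covDeriv (chartFrame E G) (twistedConnection (modelEquiv ι) D φ) f z = 0) :
    frameField G (fun z => (f z).1) ∈ localSymmetries
      (leftInvariantDistribution (S.map ι.toLinearEquiv.toLinearMap))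
      (leftInvariantDistribution (T.map ι.toLinearEquiv.toLinearMap)) (chartInv E G y) := by
  refine (eventually_chartInv_iff hy).1 ?_
  filter_upwards [hf.eventually (by simp), hcov, chartDomain_mem_nhds hy] with z hfz hcovz hz
  have hpres {S : Submodule ℂ 𝔤} (hS : ∀ x ∈ S, D x ∈ S) := by
    refine preservesDistributionAt_frameField ι hz hfz.fst S fun b hb => ?_
    rw [fst_fderiv_of_covDeriv_eq_zero (hfz.differentiableAt (by simp)) hcovz, sub_sub_cancel]
    exact S.smul_mem _ (hS _ hb)
  exact ⟨holomorphicVectorFieldAt_frameField hz hfz.fst, hpres hS, hpres hT⟩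

theorem finrank_add_one_le_ilcSymDim [LieAlgebra.IsSolvable 𝔤]
    (ι : 𝔤 ≃ₗ⁅ℂ⁆ GroupLieAlgebra 𝓘(ℂ, E) G) (𝔢 𝔣 : LieSubalgebra ℂ 𝔤)
    (hD : IsTwistedDerivation D φ) (hD0 : D ≠ 0) (h𝔢 : ∀ x ∈ 𝔢, D x ∈ 𝔢) (h𝔣 : ∀ x ∈ 𝔣, D x ∈ 𝔣) :
    (Module.finrank ℂ 𝔤 + 1 : ℕ) ≤ ilcSymDim ι 𝔢 𝔣 := by
  let y₀ : E := extChartAt 𝓘(ℂ, E) (1 : G) 1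
  have hy₀ : y₀ ∈ chartDomain E G := mem_extChartAt_target 1
  have hinv : chartInv E G y₀ = 1 := extChartAt_to_inv 1
  obtain ⟨Φ, hΦ, hΦ0, hcov⟩ :=
    (isLieFrameAt_chartFrame ι hy₀).exists_parallel_frame hD.isFlatConnection
  have hΦw (w : E × ℂ) : ContDiffAt ℂ ω (fun y => Φ y w) y₀ := hΦ.clm_apply contDiffAt_const
  let Ψ : E × ℂ →ₗ[ℂ] Π x : G, TangentSpace 𝓘(ℂ, E) x :=
    (frameField G).comp (LinearMap.pi fun y => (LinearMap.fst ℂ E ℂ).comp (Φ y).toLinearMap)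
  have hΨ (w : E × ℂ) : Ψ w ∈ localSymmetries _ _ 1 :=
    hinv ▸ frameField_mem_localSymmetries ι h𝔢 h𝔣 hy₀ (hΦw w) (hcov.mono fun _ h => h w)
  have hinj : Function.Injective
      ((Submodule.mkQ ((vanishingNear (1 : G)).comap (Submodule.subtype _))).comp
        (Ψ.codRestrict _ hΨ)) := by
    refine (injective_iff_map_eq_zero _).2 fun w hw => ?_
    have hvan : ∀ᶠ q in 𝓝 (1 : G), Ψ w q = 0 := (Submodule.Quotient.mk_eq_zero _).1 hw
    have hfst : (fun y => (Φ y w).1) =ᶠ[𝓝 y₀] 0 := by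
      rw [← hinv, ← eventually_chartInv_iff hy₀] at hvan
      filter_upwards [hvan, chartDomain_mem_nhds hy₀] with z hz hzdom
      rw [← (extChartAt 𝓘(ℂ, E) (1 : G)).right_inv hzdom]
      exact (frameField_apply_eq_zero_iff _ _).1 hz
    simpa [hΦ0] using eq_zero_of_covDeriv_eq_zero hD0 ((hΦw w).differentiableAt (by simp))
      (hcov.self_of_nhds w) hfst
  have hrank := LinearMap.lift_rank_le_of_injective _ hinj
  have : FiniteDimensional ℂ 𝔤 := Module.Finite.equiv (modelEquiv ι)
  rw [ilcSymDim]
  simpa [← Module.finrank_eq_rank, (modelEquiv ι).finrank_eq] using hrank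

end SymmetryGerms

/-! ### Construction of twisted derivations -/

section LinearAlgebra

variable {K V : Type*} [Field K] [AddCommGroup V] [Module K V]

theorem span_range_eq_of_linearIndependent {ι : Type*} [Fintype ι] {S : Submodule K V}
    [FiniteDimensional K S] {v : ι → V} (hv : LinearIndependent K v) (hvS : ∀ i, v i ∈ S)
    (hS : Module.finrank K S = Fintype.card ι) : Submodule.span K (Set.range v) = S :=
  Submodule.eq_of_le_of_finrank_eq (Submodule.span_le.2 (Set.range_subset_iff.2 hvS))
    (by rw [finrank_span_eq_card hv, hS])

theorem span_pair_eq_of_notMem_of_mem {S N : Submodule K V} (hS : Module.finrank K S = 2) {x y : V}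
    (hx : x ∈ S) (hxN : x ∉ N) (hy : y ∈ S) (hyN : y ∈ N) (hy0 : y ≠ 0) :
    Submodule.span K {x, y} = S := by
  have : FiniteDimensional K S := Module.finite_of_finrank_pos (by lia)
  have hli : LinearIndependent K ![y, x] := by
    rw [LinearIndependent.pair_iff' hy0]
    rintro a rfl
    exact hxN (N.smul_mem a hyN)
  rw [← span_range_eq_of_linearIndependent hli (Fin.forall_fin_two.2 ⟨hy, hx⟩) (by simp [hS]),
    Matrix.range_cons_cons_empty, Set.pair_comm]

theorem exists_eq_smul_of_mem_inf {S N : Submodule K V} (hS : Module.finrank K S = 2) {x y w : V}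
    (hx : x ∈ S) (hxN : x ∉ N) (hy : y ∈ S) (hyN : y ∈ N) (hy0 : y ≠ 0) (hw : w ∈ S)
    (hwN : w ∈ N) : ∃ c : K, w = c • y := by
  rw [← span_pair_eq_of_notMem_of_mem hS hx hxN hy hyN hy0, Submodule.mem_span_pair] at hw
  obtain ⟨s, t, rfl⟩ := hw
  have hs : s • x ∈ N := (N.add_mem_iff_left (N.smul_mem t hyN)).1 hwN
  rcases eq_or_ne s 0 with rfl | hs0
  · exact ⟨t, by simp⟩
  · exact absurd ((N.smul_mem_iff hs0).1 hs) hxN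

variable [FiniteDimensional K V]

theorem exists_mem_inf_ne_zero {S N : Submodule K V}
    (h : Module.finrank K V < Module.finrank K S + Module.finrank K N) :
    ∃ x ∈ S ⊓ N, x ≠ 0 := by
  rw [← Submodule.ne_bot_iff]
  intro hbot
  have hsum := Submodule.finrank_sup_add_finrank_inf_eq S N
  have hle := Submodule.finrank_le (S ⊔ N)
  rw [hbot, finrank_bot] at hsum
  lia

theorem exists_sub_smul_mem {S N : Submodule K V} (hle : S ≤ N)
    (hfin : Module.finrank K N = Module.finrank K S + 1) {y w : V} (hy : y ∈ N) (hyS : y ∉ S)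
    (hw : w ∈ N) : ∃ c : K, w - c • y ∈ S := by
  have hlt : S < S ⊔ Submodule.span K {y} := lt_of_le_of_ne le_sup_left fun heq =>
    hyS (heq ▸ Submodule.mem_sup_right (Submodule.mem_span_singleton_self y))
  have hsup : S ⊔ Submodule.span K {y} = N := Submodule.eq_of_le_of_finrank_le
    (sup_le hle ((Submodule.span_singleton_le_iff_mem _ _).2 hy))
    (hfin ▸ Submodule.finrank_lt_finrank_of_lt hlt)
  obtain ⟨u, hu, _, hv, rfl⟩ := Submodule.mem_sup.1 (hsup ▸ hw)
  obtain ⟨c, rfl⟩ := Submodule.mem_span_singleton.1 hv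
  exact ⟨c, by simpa using hu⟩

/- Modulo `A ⊓ B`, the lines `A`, `B` and `K e` are three distinct eigenlines of `T` in the plane
`A ⊔ B`. -/
theorem apply_sub_smul_mem_inf {A B : Submodule K V}
    (hA : Module.finrank K A = Module.finrank K ↥(A ⊓ B) + 1)
    (hB : Module.finrank K B = Module.finrank K ↥(A ⊓ B) + 1) {T : Module.End K V}
    (hTA : ∀ x ∈ A, T x ∈ A) (hTB : ∀ x ∈ B, T x ∈ B) {μ : K} {e w : V} (hTe : T e = μ • e)
    (he : e ∈ A ⊔ B) (heA : e ∉ A) (heB : e ∉ B) (hw : w ∈ A ⊔ B) : T w - μ • w ∈ A ⊓ B := by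
  let N := T - μ • LinearMap.id
  have hNA x (hx : x ∈ A) : N x ∈ A := sub_mem (hTA x hx) (A.smul_mem μ hx)
  have hNB x (hx : x ∈ B) : N x ∈ B := sub_mem (hTB x hx) (B.smul_mem μ hx)
  obtain ⟨p, hp, q, hq, rfl⟩ := Submodule.mem_sup.1 he
  obtain ⟨a, ha, b, hb, rfl⟩ := Submodule.mem_sup.1 hw
  have hpB : p ∉ B := fun h => heB (add_mem h hq)
  have hqA : q ∉ A := fun h => heA (add_mem hp h)
  have hpq : N p + N q = 0 := by rw [← map_add]; exact sub_eq_zero.2 hTe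
  have hNp : N p ∈ A ⊓ B := ⟨hNA p hp, eq_neg_of_add_eq_zero_left hpq ▸ neg_mem (hNB q hq)⟩
  have hNq : N q ∈ A ⊓ B := ⟨eq_neg_of_add_eq_zero_right hpq ▸ neg_mem (hNA p hp), hNB q hq⟩
  have map_mem_of_congr {y x : V} (hy : N y ∈ A ⊓ B) (hx : ∃ c : K, x - c • y ∈ A ⊓ B) :
      N x ∈ A ⊓ B := by
    obtain ⟨c, hc⟩ := hx
    have hNc : N (x - c • y) ∈ A ⊓ B := ⟨hNA _ hc.1, hNB _ hc.2⟩
    rw [map_sub, map_smul] at hNc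
    exact ((A ⊓ B).sub_mem_iff_left ((A ⊓ B).smul_mem c hy)).1 hNc
  have hNa := map_mem_of_congr hNp (exists_sub_smul_mem inf_le_left hA hp (fun h => hpB h.2) ha)
  have hNb := map_mem_of_congr hNq (exists_sub_smul_mem inf_le_right hB hq (fun h => hqA h.1) hb)
  change N (a + b) ∈ A ⊓ B
  rw [map_add]
  exact add_mem hNa hNb

end LinearAlgebra

section ConjugateLinear

variable {V : Type*} [AddCommGroup V] [Module ℂ V] {τ : V →ₛₗ[starRingEnd ℂ] V}

theorem finrank_map_conj (hτ : Function.Injective τ) (S : Submodule ℂ V) :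
    Module.finrank ℂ (S.map τ) = Module.finrank ℂ S := by
  let j := S.equivMapOfInjective τ hτ
  exact congrArg Cardinal.toNat (rank_eq_of_equiv_equiv (starRingEnd ℂ) j.toAddEquiv
    (starRingAut (R := ℂ)).bijective j.map_smulₛₗ).symm

theorem exists_fixed_mem_notMem (hτ : Function.Involutive τ) {A S : Submodule ℂ V}
    (hA : ∀ x ∈ A, τ x ∈ A) (hAS : ¬ A ≤ S) : ∃ x ∈ A, x ∉ S ∧ τ x = x := by
  obtain ⟨z, hz, hzS⟩ := SetLike.not_le_iff_exists.1 hAS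
  by_cases hsum : z + τ z ∈ S
  · refine ⟨Complex.I • (z - τ z), A.smul_mem _ (sub_mem hz (hA z hz)), fun hdiff => hzS ?_, ?_⟩
    · rw [S.smul_mem_iff Complex.I_ne_zero] at hdiff
      rw [← S.smul_mem_iff (two_ne_zero (α := ℂ))]
      convert add_mem hsum hdiff using 1
      module
    · rw [map_smulₛₗ, map_sub, hτ z, Complex.conj_I]
      module
  · exact ⟨z + τ z, add_mem hz (hA z hz), hsum, by rw [map_add, hτ z, add_comm]⟩

end ConjugateLinear

section AbelianIdealOfCodimensionTwo

open LieAlgebra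

variable {K L : Type*} [Field K] [LieRing L] [LieAlgebra K L]

theorem isSolvable_of_isSolvable_quotient (I : LieIdeal K L) [IsSolvable I] [IsSolvable (L ⧸ I)] :
    IsSolvable L := by
  obtain ⟨k, hk⟩ := IsSolvable.solvable K (L ⧸ I)
  obtain ⟨l, hl⟩ := IsSolvable.solvable K I
  let π : L →ₗ⁅K⁆ L ⧸ I :=
    { (LieSubmodule.Quotient.mk' I : L →ₗ[K] L ⧸ I) with
      map_lie' := rfl }
  have hπ : Function.Surjective π := LieSubmodule.Quotient.surjective_mk' I
  have hkI : derivedSeries K L k ≤ I := fun x hx => by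
    have hπx := LieIdeal.mem_map (f := π) hx
    rw [LieIdeal.derivedSeries_map_eq k hπ, hk] at hπx
    exact (LieSubmodule.Quotient.mk_eq_zero I).1 hπx
  refine IsSolvable.mk (R := K) (k := l + k) (le_bot_iff.1 ?_)
  rw [LieIdeal.derivedSeries_eq_bot_iff] at hl
  rw [derivedSeries_def, derivedSeriesOfIdeal_add, ← hl]
  exact derivedSeriesOfIdeal_mono hkI l

theorem isSolvable_of_finrank_eq_two (h : Module.finrank K L = 2) : IsSolvable L := by
  have : FiniteDimensional K L := Module.finite_of_finrank_pos (by lia)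
  let B := Module.finBasisOfFinrankEq K L h
  have hderived : (derivedSeries K L 1).toSubmodule ≤ Submodule.span K {⁅B 0, B 1⁆} := by
    refine (coe_derivedSeries_one_eq K L).trans_le (Submodule.span_le.2 ?_)
    rintro _ ⟨x, y, rfl⟩
    refine Submodule.mem_span_singleton.2
      ⟨B.repr x 0 * B.repr y 1 - B.repr x 1 * B.repr y 0, ?_⟩
    conv_rhs => rw [← B.sum_repr x, ← B.sum_repr y, Fin.sum_univ_two, Fin.sum_univ_two]
    simp only [add_lie, lie_add, smul_lie, lie_smul, lie_self]
    rw [← lie_skew (B 0) (B 1)]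
    module
  refine IsSolvable.mk (R := K) (k := 2) (le_bot_iff.1 ?_)
  rw [derivedSeries_def, derivedSeriesOfIdeal_succ, LieSubmodule.lie_le_iff]
  intro x hx y hy
  obtain ⟨s, rfl⟩ := Submodule.mem_span_singleton.1 (hderived hx)
  obtain ⟨t, rfl⟩ := Submodule.mem_span_singleton.1 (hderived hy)
  simp

theorem isSolvable_of_isLieAbelian_of_finrank [FiniteDimensional K L] (I : LieIdeal K L)
    [IsLieAbelian I] (h : Module.finrank K L = Module.finrank K I + 2) : IsSolvable L := by
  have hquot : Module.finrank K (L ⧸ I) = 2 := by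
    have := I.toSubmodule.finrank_quotient_add_finrank
    change Module.finrank K (L ⧸ I) + Module.finrank K I = _ at this
    lia
  have := isSolvable_of_finrank_eq_two hquot
  exact isSolvable_of_isSolvable_quotient I

end AbelianIdealOfCodimensionTwo

section AdaptedTwistedDerivation

variable {𝔤 : Type*} [LieRing 𝔤] [LieAlgebra ℂ 𝔤] {D : 𝔤 →ₗ[ℂ] 𝔤} {φ : 𝔤 →ₗ[ℂ] ℂ}

/-- The two identities defining a twisted derivation `(D, φ)`, for a single pair of vectors. -/
def TwistedAt (D : 𝔤 →ₗ[ℂ] 𝔤) (φ : 𝔤 →ₗ[ℂ] ℂ) (x y : 𝔤) : Prop :=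
  D ⁅x, y⁆ = ⁅D x, y⁆ + ⁅x, D y⁆ + φ y • D x - φ x • D y ∧ φ ⁅x, y⁆ = 0

theorem TwistedAt.symm {x y : 𝔤} (h : TwistedAt D φ x y) : TwistedAt D φ y x := by
  refine ⟨?_, by rw [← lie_skew, map_neg, h.2, neg_zero]⟩
  rw [← lie_skew, map_neg, h.1, ← lie_skew x, ← lie_skew (D x)]
  abel

theorem TwistedAt.self (x : 𝔤) : TwistedAt D φ x x := by
  refine ⟨?_, by rw [lie_self, map_zero]⟩
  rw [lie_self, map_zero, ← lie_skew x]
  abel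

theorem IsTwistedDerivation.of_basis {ι : Type*} [LinearOrder ι] (B : Module.Basis ι ℂ 𝔤)
    (h : ∀ i j, i < j → TwistedAt D φ (B i) (B j)) : IsTwistedDerivation D φ := by
  have hB i j : TwistedAt D φ (B i) (B j) := by
    rcases lt_trichotomy i j with hij | rfl | hij
    exacts [h i j hij, .self _, (h j i hij).symm]
  let br : 𝔤 →ₗ[ℂ] 𝔤 →ₗ[ℂ] 𝔤 := LieModule.toEnd ℂ 𝔤 𝔤
  let smulφ : 𝔤 →ₗ[ℂ] 𝔤 →ₗ[ℂ] 𝔤 := (LinearMap.lsmul ℂ 𝔤).comp φ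
  have hlie : br.compr₂ D = br.comp D + br.compl₂ D + smulφ.flip.comp D - smulφ.compl₂ D :=
    LinearMap.ext_basis B B fun i j => (hB i j).1
  have hchar : br.compr₂ φ = 0 := LinearMap.ext_basis B B fun i j => (hB i j).2
  exact ⟨LinearMap.congr_fun₂ hlie, LinearMap.congr_fun₂ hchar⟩

/-- There is a nonzero twisted derivation of `𝔤` that maps `𝔢` and `𝔣` into themselves. -/
def HasTwistedDerivation (𝔢 𝔣 : LieSubalgebra ℂ 𝔤) : Prop :=
  ∃ (D : 𝔤 →ₗ[ℂ] 𝔤) (φ : 𝔤 →ₗ[ℂ] ℂ), IsTwistedDerivation D φ ∧ D ≠ 0 ∧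
    (∀ x ∈ 𝔢, D x ∈ 𝔢) ∧ ∀ x ∈ 𝔣, D x ∈ 𝔣

end AdaptedTwistedDerivation

section AdaptedFrame

variable {𝔤 : Type*} [LieRing 𝔤] [LieAlgebra ℂ 𝔤] {𝔢 𝔣 : LieSubalgebra ℂ 𝔤}

namespace IsILCTriple

theorem finiteDimensional (h : IsILCTriple 𝔢 𝔣) : FiniteDimensional ℂ 𝔤 :=
  Module.finite_of_finrank_pos (by rw [h.finrank_eq]; lia)

theorem finrank_sup (h : IsILCTriple 𝔢 𝔣) :
    Module.finrank ℂ ↥(𝔢.toSubmodule ⊔ 𝔣.toSubmodule) = 4 := by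
  have := h.finiteDimensional
  have hsum := Submodule.finrank_sup_add_finrank_inf_eq 𝔢.toSubmodule 𝔣.toSubmodule
  rw [h.inf_eq_bot, finrank_bot] at hsum
  exact hsum.trans (congrArg₂ _ h.finrank_left h.finrank_right)

theorem eq_zero_of_mem (h : IsILCTriple 𝔢 𝔣) {x : 𝔤} (hx : x ∈ 𝔢) (hx' : x ∈ 𝔣) : x = 0 :=
  (Submodule.eq_bot_iff _).1 h.inf_eq_bot x ⟨hx, hx'⟩

theorem eq_zero_of_add_eq_zero (h : IsILCTriple 𝔢 𝔣) {x y : 𝔤} (hx : x ∈ 𝔢) (hy : y ∈ 𝔣)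
    (hxy : x + y = 0) : x = 0 :=
  h.eq_zero_of_mem hx (eq_neg_of_add_eq_zero_left hxy ▸ neg_mem hy)

theorem eq_bot_of_le_sup (h : IsILCTriple 𝔢 𝔣) {I : LieIdeal ℂ 𝔤}
    (hI : I.toSubmodule ≤ 𝔢.toSubmodule ⊔ 𝔣.toSubmodule) : I = ⊥ :=
  (LieSubmodule.eq_bot_iff I).2 fun x hx =>
    h.nondegenerate x (hI hx) fun y _ => hI (lie_mem_left ℂ 𝔤 I x y hx)

theorem eq_zero_of_lie_mem_sup (h : IsILCTriple 𝔢 𝔣) {x f y : 𝔤} (hx : x ∈ 𝔢)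
    (hfy : Submodule.span ℂ {f, y} = 𝔣.toSubmodule)
    (hxf : ⁅x, f⁆ ∈ 𝔢.toSubmodule ⊔ 𝔣.toSubmodule)
    (hxy : ⁅x, y⁆ ∈ 𝔢.toSubmodule ⊔ 𝔣.toSubmodule) : x = 0 := by
  refine h.nondegenerate x (Submodule.mem_sup_left hx) fun w hw => ?_
  obtain ⟨u, hu, v, hv, rfl⟩ := Submodule.mem_sup.1 hw
  rw [← hfy] at hv
  obtain ⟨s, t, rfl⟩ := Submodule.mem_span_pair.1 hv
  rw [lie_add, lie_add, lie_smul, lie_smul]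
  exact add_mem (Submodule.mem_sup_left (𝔢.lie_mem hx hu))
    (add_mem (Submodule.smul_mem _ _ hxf) (Submodule.smul_mem _ _ hxy))

end IsILCTriple

/-- The vectors `e, x` span `𝔢`, the vectors `f, y` span `𝔣`, and `z` lies outside `𝔢 ⊔ 𝔣`.
For an ILC triple these are the bases of `𝔤` adapted to `𝔢` and `𝔣`. -/
structure IsAdaptedFrame (𝔢 𝔣 : LieSubalgebra ℂ 𝔤) (e x f y z : 𝔤) : Prop where
  left : Submodule.span ℂ {e, x} = 𝔢.toSubmodule
  right : Submodule.span ℂ {f, y} = 𝔣.toSubmodule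
  notMem : z ∉ 𝔢.toSubmodule ⊔ 𝔣.toSubmodule

namespace IsAdaptedFrame

variable {e x f y z : 𝔤}

theorem exists_basis (hF : IsAdaptedFrame 𝔢 𝔣 e x f y z) (h : IsILCTriple 𝔢 𝔣) :
    ∃ B : Module.Basis (Fin 5) ℂ 𝔤, ⇑B = ![e, x, f, y, z] := by
  have := h.finiteDimensional
  let S := Submodule.span ℂ (Set.range ![e, x, f, y, z])
  have hS i : ![e, x, f, y, z] i ∈ S := Submodule.subset_span ⟨i, rfl⟩
  have hle : 𝔢.toSubmodule ⊔ 𝔣.toSubmodule ≤ S := by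
    rw [← hF.left, ← hF.right]
    exact sup_le (Submodule.span_le.2 (Set.pair_subset (hS 0) (hS 1)))
      (Submodule.span_le.2 (Set.pair_subset (hS 2) (hS 3)))
  have hlt := Submodule.finrank_lt_finrank_of_lt
    (lt_of_le_of_ne hle fun heq => hF.notMem (heq ▸ hS 4))
  rw [h.finrank_sup] at hlt
  have htop : S = ⊤ := Submodule.eq_top_of_finrank_eq
    (le_antisymm (Submodule.finrank_le S) (h.finrank_eq ▸ hlt))
  exact ⟨basisOfTopLeSpanOfCardEqFinrank _ htop.ge (by simp [h.finrank_eq]),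
    coe_basisOfTopLeSpanOfCardEqFinrank _ _ _⟩

theorem exists_linearMap (hF : IsAdaptedFrame 𝔢 𝔣 e x f y z) (h : IsILCTriple 𝔢 𝔣)
    {W : Type*} [AddCommGroup W] [Module ℂ W] (w₁ w₂ w₃ w₄ w₅ : W) :
    ∃ L : 𝔤 →ₗ[ℂ] W, L e = w₁ ∧ L x = w₂ ∧ L f = w₃ ∧ L y = w₄ ∧ L z = w₅ := by
  obtain ⟨B, hB⟩ := hF.exists_basis h
  have hL i : B.constr ℂ ![w₁, w₂, w₃, w₄, w₅] (![e, x, f, y, z] i) =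
      ![w₁, w₂, w₃, w₄, w₅] i := by
    rw [← hB, B.constr_basis]
  exact ⟨_, hL 0, hL 1, hL 2, hL 3, hL 4⟩

theorem hasTwistedDerivation (hF : IsAdaptedFrame 𝔢 𝔣 e x f y z) (h : IsILCTriple 𝔢 𝔣)
    {D : 𝔤 →ₗ[ℂ] 𝔤} {φ : 𝔤 →ₗ[ℂ] ℂ} (hD0 : D ≠ 0) (he : D e ∈ 𝔢) (hx : D x ∈ 𝔢)
    (hf : D f ∈ 𝔣) (hy : D y ∈ 𝔣) (hD : [e, x, f, y, z].Pairwise (TwistedAt D φ)) :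
    HasTwistedDerivation 𝔢 𝔣 := by
  obtain ⟨B, hB⟩ := hF.exists_basis h
  have hpair : (List.ofFn B).Pairwise (TwistedAt D φ) := hB ▸ hD
  have hleft : 𝔢.toSubmodule ≤ 𝔢.toSubmodule.comap D :=
    hF.left.ge.trans (Submodule.span_le.2 (Set.pair_subset he hx))
  have hright : 𝔣.toSubmodule ≤ 𝔣.toSubmodule.comap D :=
    hF.right.ge.trans (Submodule.span_le.2 (Set.pair_subset hf hy))
  exact ⟨D, φ, .of_basis B fun i j hij => List.pairwise_ofFn.1 hpair hij, hD0, hleft, hright⟩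

end IsAdaptedFrame

end AdaptedFrame

section AbelianIdeals

variable {R L : Type*} [CommRing R] [LieRing L] [LieAlgebra R L]

theorem lie_eq_zero_of_mem {I : LieIdeal R L} [IsLieAbelian I] {x y : L} (hx : x ∈ I)
    (hy : y ∈ I) : ⁅x, y⁆ = 0 :=
  congrArg Subtype.val (trivial_lie_zero I I ⟨x, hx⟩ ⟨y, hy⟩)

variable (I J : LieIdeal R L) [IsLieAbelian I] [IsLieAbelian J]

theorem sup_lie_sup_le_inf : ⁅I ⊔ J, I ⊔ J⁆ ≤ I ⊓ J := by
  rw [LieSubmodule.sup_lie, LieSubmodule.lie_sup, LieSubmodule.lie_sup,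
    (LieSubmodule.lie_abelian_iff_lie_self_eq_bot I).1 inferInstance,
    (LieSubmodule.lie_abelian_iff_lie_self_eq_bot J).1 inferInstance, bot_sup_eq, sup_bot_eq,
    LieSubmodule.lie_comm J I, sup_idem]
  exact LieSubmodule.lie_le_inf I J

theorem sup_lie_inf_eq_bot : ⁅I ⊔ J, I ⊓ J⁆ = ⊥ := by
  rw [LieSubmodule.sup_lie, sup_eq_bot_iff]
  exact ⟨eq_bot_mono (LieSubmodule.mono_lie_right I inf_le_left)
    ((LieSubmodule.lie_abelian_iff_lie_self_eq_bot I).1 inferInstance),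
    eq_bot_mono (LieSubmodule.mono_lie_right J inf_le_right)
    ((LieSubmodule.lie_abelian_iff_lie_self_eq_bot J).1 inferInstance)⟩

variable {I J}

theorem lie_mem_inf_of_mem_sup {x y : L} (hx : x ∈ I ⊔ J) (hy : y ∈ I ⊔ J) : ⁅x, y⁆ ∈ I ⊓ J :=
  sup_lie_sup_le_inf I J (LieSubmodule.lie_mem_lie hx hy)

theorem lie_eq_zero_of_mem_sup_of_mem_inf {x y : L} (hx : x ∈ I ⊔ J) (hy : y ∈ I ⊓ J) :
    ⁅x, y⁆ = 0 := by
  simpa only [sup_lie_inf_eq_bot, LieSubmodule.mem_bot] using LieSubmodule.lie_mem_lie hx hy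

end AbelianIdeals

theorem exists_lie_eq_smul {K L : Type*} [Field K] [LieRing L] [LieAlgebra K L]
    {H : LieSubalgebra K L} (hH : Module.finrank K H = 2) {I : LieIdeal K L} {x y : L}
    (hx : x ∈ H) (hxI : x ∉ I) (hy : y ∈ H) (hyI : y ∈ I) (hy0 : y ≠ 0) :
    ∃ c : K, ⁅x, y⁆ = c • y :=
  exists_eq_smul_of_mem_inf (N := I.toSubmodule) hH hx hxI hy hyI hy0 (H.lie_mem hx hy)
    (lie_mem_right K L I x y hyI)

theorem IsILCTriple.isAdaptedFrame {𝔤 : Type*} [LieRing 𝔤] [LieAlgebra ℂ 𝔤]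
    {𝔢 𝔣 : LieSubalgebra ℂ 𝔤} (h : IsILCTriple 𝔢 𝔣) {N : Submodule ℂ 𝔤} {e x f y z : 𝔤}
    (he : e ∈ 𝔢) (heN : e ∉ N) (hx : x ∈ 𝔢) (hxN : x ∈ N) (hx0 : x ≠ 0) (hf : f ∈ 𝔣)
    (hfN : f ∉ N) (hy : y ∈ 𝔣) (hyN : y ∈ N) (hy0 : y ≠ 0)
    (hz : z ∈ 𝔢.toSubmodule ⊔ 𝔣.toSubmodule →
      ⁅x, f⁆ ∈ 𝔢.toSubmodule ⊔ 𝔣.toSubmodule ∧ ⁅x, y⁆ ∈ 𝔢.toSubmodule ⊔ 𝔣.toSubmodule) :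
    IsAdaptedFrame 𝔢 𝔣 e x f y z :=
  have hright := span_pair_eq_of_notMem_of_mem h.finrank_right hf hfN hy hyN hy0
  { left := span_pair_eq_of_notMem_of_mem h.finrank_left he heN hx hxN hx0
    right := hright
    notMem := fun hmem => hx0 (h.eq_zero_of_lie_mem_sup hx hright (hz hmem).1 (hz hmem).2) }

section BracketTables

variable {𝔤 : Type*} [LieRing 𝔤] [LieAlgebra ℂ 𝔤] {𝔢 𝔣 : LieSubalgebra ℂ 𝔤} {e x f y z : 𝔤}

namespace IsAdaptedFrame

theorem left_mem (hF : IsAdaptedFrame 𝔢 𝔣 e x f y z) : x ∈ 𝔢 :=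
  hF.left.le (Submodule.mem_span_pair.2 ⟨0, 1, by module⟩)

theorem right_mem (hF : IsAdaptedFrame 𝔢 𝔣 e x f y z) : y ∈ 𝔣 :=
  hF.right.le (Submodule.mem_span_pair.2 ⟨0, 1, by module⟩)

theorem hasTwistedDerivation_of_eigenvectors (hF : IsAdaptedFrame 𝔢 𝔣 e x f y z)
    (h : IsILCTriple 𝔢 𝔣) {μ ν c₁ c₂ : ℂ} (hx0 : x ≠ 0) (lie_e_x : ⁅e, x⁆ = μ • x)
    (lie_f_y : ⁅f, y⁆ = ν • y) (lie_x_f : ⁅x, f⁆ = μ • x) (lie_e_y : ⁅e, y⁆ = -(ν • y))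
    (lie_x_y : ⁅x, y⁆ = z) (lie_e_f : ⁅e, f⁆ = c₁ • z + c₂ • (e + f))
    (lie_ef_z : ⁅e + f, z⁆ = 0) (lie_x_z : ⁅x, z⁆ = 0) (lie_y_z : ⁅y, z⁆ = 0) :
    HasTwistedDerivation 𝔢 𝔣 := by
  have lie_e_z : ⁅e, z⁆ = (μ - ν) • z := by
    rw [← lie_x_y, leibniz_lie, lie_e_x, lie_e_y, smul_lie, lie_neg, lie_smul]
    module
  have lie_f_z : ⁅f, z⁆ = -((μ - ν) • z) := by
    rwa [add_lie, lie_e_z, add_comm, add_eq_zero_iff_eq_neg] at lie_ef_z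
  have lie_z_y : ⁅z, y⁆ = 0 := by rw [← lie_skew, lie_y_z, neg_zero]
  obtain ⟨D, De, Dx, Df, Dy, Dz⟩ := hF.exists_linearMap h 0 x 0 (-y) 0
  refine hF.hasTwistedDerivation h (D := D) (φ := 0) (fun hD => hx0 (by rw [← Dx, hD]; rfl))
    (De ▸ zero_mem 𝔢) (Dx.symm ▸ hF.left_mem) (Df ▸ zero_mem 𝔣)
    (Dy.symm ▸ neg_mem hF.right_mem) ?_
  simp [TwistedAt, lie_e_x, lie_e_f, lie_e_y, lie_e_z, lie_x_f, lie_x_y, lie_x_z, lie_f_y, lie_f_z,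
    lie_y_z, lie_z_y, De, Dx, Df, Dy, Dz]

theorem hasTwistedDerivation_of_lie_eq_add (hF : IsAdaptedFrame 𝔢 𝔣 e x f y z)
    (h : IsILCTriple 𝔢 𝔣) {μ : ℂ} (hx0 : x ≠ 0) (lie_e_x : ⁅e, x⁆ = μ • x)
    (lie_f_y : ⁅f, y⁆ = -μ • y) (lie_x_y : ⁅x, y⁆ = 0) (lie_x_f : ⁅x, f⁆ = z + μ • x)
    (lie_e_y : ⁅e, y⁆ = z + μ • y) (lie_x_z : ⁅x, z⁆ = 0) (lie_y_z : ⁅y, z⁆ = 0)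
    (lie_e_f : ∃ s t : ℂ, s • z + t • (x + y) = ⁅e, f⁆ - μ • (e + f))
    (lie_e_z : ∃ s t : ℂ, s • z + t • (x + y) = ⁅e, z⁆)
    (lie_f_z : ∃ s t : ℂ, s • z + t • (x + y) = ⁅f, z⁆) : HasTwistedDerivation 𝔢 𝔣 := by
  obtain ⟨r₁, r₂, lie_e_f⟩ := lie_e_f
  obtain ⟨s₁, s₂, lie_e_z⟩ := lie_e_z
  obtain ⟨t₁, t₂, lie_f_z⟩ := lie_f_z
  have lie_z_y : ⁅z, y⁆ = 0 := by rw [← lie_skew, lie_y_z, neg_zero]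
  rw [eq_sub_iff_add_eq'] at lie_e_f
  obtain ⟨D, De, Dx, Df, Dy, Dz⟩ := hF.exists_linearMap h x 0 (-y) 0 0
  refine hF.hasTwistedDerivation h (D := D) (φ := 0) (fun hD => hx0 (by rw [← De, hD]; rfl))
    (De.symm ▸ hF.left_mem) (Dx ▸ zero_mem 𝔢) (Df.symm ▸ neg_mem hF.right_mem)
    (Dy ▸ zero_mem 𝔣) ?_
  simp only [List.pairwise_cons, List.mem_cons, List.not_mem_nil, or_false, TwistedAt, De,
    LinearMap.zero_apply, zero_smul, add_zero, sub_zero, and_true, forall_eq_or_imp, lie_e_x,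
    map_smul, Dx, smul_zero, lie_self, lie_zero, ← lie_e_f, smul_add, map_add, Df, smul_neg, Dz,
    Dy, lie_x_f, lie_neg, lie_e_y, neg_add_rev, lie_x_y, forall_eq, ← lie_e_z, lie_x_z, and_self,
    true_and, zero_lie, zero_add, neg_zero, map_zero, neg_lie, lie_skew, lie_f_y, neg_smul,
    map_neg, ← lie_f_z, lie_z_y, lie_y_z, IsEmpty.forall_iff, implies_true, List.Pairwise.nil]
  abel

end IsAdaptedFrame

end BracketTables

section TwoIdeals

variable {𝔤 : Type*} [LieRing 𝔤] [LieAlgebra ℂ 𝔤] {𝔢 𝔣 : LieSubalgebra ℂ 𝔤}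
  {𝔞 𝔟 : LieIdeal ℂ 𝔤} {e x f y : 𝔤}

theorem lie_sub_smul_mem_inf [FiniteDimensional ℂ 𝔤] (h𝔞 : Module.finrank ℂ 𝔞 = 3)
    (h𝔟 : Module.finrank ℂ 𝔟 = 3) (hinf : Module.finrank ℂ ↥(𝔞 ⊓ 𝔟) = 2) {μ : ℂ}
    (lie_e_x : ⁅e, x⁆ = μ • x) (hxn : x ∈ 𝔞 ⊔ 𝔟) (hx𝔞 : x ∉ 𝔞) (hx𝔟 : x ∉ 𝔟) {w : 𝔤}
    (hw : w ∈ 𝔞 ⊔ 𝔟) : ⁅e, w⁆ - μ • w ∈ 𝔞 ⊓ 𝔟 := by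
  rw [← LieSubmodule.mem_toSubmodule, LieSubmodule.sup_toSubmodule] at hw hxn
  exact apply_sub_smul_mem_inf (A := 𝔞.toSubmodule) (B := 𝔟.toSubmodule)
    (T := LieAlgebra.ad ℂ 𝔤 e) (h𝔞.trans (congrArg (· + 1) hinf.symm))
    (h𝔟.trans (congrArg (· + 1) hinf.symm)) (fun w hw => lie_mem_right ℂ 𝔤 𝔞 e w hw)
    (fun w hw => lie_mem_right ℂ 𝔤 𝔟 e w hw) lie_e_x hxn hx𝔞 hx𝔟 hw

variable [IsLieAbelian 𝔞] [IsLieAbelian 𝔟]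

namespace IsILCTriple

theorem hasTwistedDerivation_of_notMem_sup (h : IsILCTriple 𝔢 𝔣)
    (hinf : Module.finrank ℂ ↥(𝔞 ⊓ 𝔟) = 2) (he : e ∈ 𝔢) (hx : x ∈ 𝔢) (hf : f ∈ 𝔣)
    (hy : y ∈ 𝔣) (hen : e ∉ 𝔞 ⊔ 𝔟) (hxn : x ∈ 𝔞 ⊔ 𝔟) (hx0 : x ≠ 0)
    (hyn : y ∈ 𝔞 ⊔ 𝔟) (hy0 : y ≠ 0) (hef : e + f ∈ 𝔞 ⊓ 𝔟) : HasTwistedDerivation 𝔢 𝔣 := by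
  have hefn : e + f ∈ 𝔞 ⊔ 𝔟 := inf_le_sup (α := LieIdeal ℂ 𝔤) hef
  have hfn : f ∉ 𝔞 ⊔ 𝔟 := fun hf => hen ((add_mem_cancel_right hf).1 hefn)
  obtain ⟨μ, lie_e_x⟩ := exists_lie_eq_smul h.finrank_left he hen hx hxn hx0
  obtain ⟨ν, lie_f_y⟩ := exists_lie_eq_smul h.finrank_right hf hfn hy hyn hy0
  have lie_x_f : ⁅x, f⁆ = μ • x := by
    have hcomm := lie_eq_zero_of_mem_sup_of_mem_inf hxn hef
    rwa [lie_add, ← lie_skew, lie_e_x, neg_add_eq_zero, eq_comm] at hcomm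
  have lie_e_y : ⁅e, y⁆ = -(ν • y) := by
    have hcomm := lie_eq_zero_of_mem_sup_of_mem_inf hyn hef
    rwa [← lie_skew, neg_eq_zero, add_lie, lie_f_y, add_eq_zero_iff_eq_neg] at hcomm
  obtain ⟨z, lie_x_y⟩ : ∃ z, ⁅x, y⁆ = z := ⟨_, rfl⟩
  have hzm : z ∈ 𝔞 ⊓ 𝔟 := lie_x_y ▸ lie_mem_inf_of_mem_sup hxn hyn
  have hF : IsAdaptedFrame 𝔢 𝔣 e x f y z :=
    h.isAdaptedFrame (N := (𝔞 ⊔ 𝔟).toSubmodule) he hen hx hxn hx0 hf hfn hy hyn hy0 fun hz =>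
      ⟨lie_x_f ▸ Submodule.mem_sup_left (𝔢.smul_mem μ hx), lie_x_y ▸ hz⟩
  have hef0 : e + f ≠ 0 := fun h0 =>
    hen (h.eq_zero_of_add_eq_zero he hf h0 ▸ zero_mem (𝔞 ⊔ 𝔟))
  have hspan := span_pair_eq_of_notMem_of_mem (S := (𝔞 ⊓ 𝔟).toSubmodule) hinf hzm hF.notMem hef
    (Submodule.add_mem_sup he hf) hef0
  obtain ⟨c₁, c₂, hc⟩ := Submodule.mem_span_pair.1 (hspan.ge (lie_mem_right ℂ 𝔤 _ e _ hef))
  have lie_e_f : ⁅e, f⁆ = c₁ • z + c₂ • (e + f) := by rw [hc, lie_add, lie_self, zero_add]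
  exact hF.hasTwistedDerivation_of_eigenvectors h hx0 lie_e_x lie_f_y lie_x_f lie_e_y lie_x_y
    lie_e_f (lie_eq_zero_of_mem_sup_of_mem_inf hefn hzm)
    (lie_eq_zero_of_mem_sup_of_mem_inf hxn hzm) (lie_eq_zero_of_mem_sup_of_mem_inf hyn hzm)

theorem hasTwistedDerivation_of_mem_sup (h : IsILCTriple 𝔢 𝔣)
    (h𝔞 : Module.finrank ℂ 𝔞 = 3) (h𝔟 : Module.finrank ℂ 𝔟 = 3)
    (hinf : Module.finrank ℂ ↥(𝔞 ⊓ 𝔟) = 2) (he : e ∈ 𝔢) (hx : x ∈ 𝔢) (hf : f ∈ 𝔣)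
    (hy : y ∈ 𝔣) (hen : e ∉ 𝔞 ⊔ 𝔟) (hxn : x ∈ 𝔞 ⊔ 𝔟) (hx𝔞 : x ∉ 𝔞) (hx𝔟 : x ∉ 𝔟)
    (hef : e + f ∈ 𝔞 ⊔ 𝔟) (hxy : x + y ∈ 𝔞 ⊓ 𝔟) : HasTwistedDerivation 𝔢 𝔣 := by
  have := h.finiteDimensional
  have hfn : f ∉ 𝔞 ⊔ 𝔟 := fun hf => hen ((add_mem_cancel_right hf).1 hef)
  have hyn : y ∈ 𝔞 ⊔ 𝔟 := (add_mem_cancel_left hxn).1 (inf_le_sup (α := LieIdeal ℂ 𝔤) hxy)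
  have hx0 : x ≠ 0 := fun h0 => hx𝔞 (h0 ▸ zero_mem 𝔞)
  have hym : y ∉ 𝔞 ⊓ 𝔟 := fun hy => hx𝔞 ((add_mem_cancel_right hy).1 hxy).1
  have hy0 : y ≠ 0 := fun h0 => hym (h0 ▸ zero_mem (𝔞 ⊓ 𝔟))
  obtain ⟨μ, lie_e_x⟩ := exists_lie_eq_smul h.finrank_left he hen hx hxn hx0
  obtain ⟨ν, lie_f_y⟩ := exists_lie_eq_smul h.finrank_right hf hfn hy hyn hy0
  have heig {w} (hw : w ∈ 𝔞 ⊔ 𝔟) := lie_sub_smul_mem_inf h𝔞 h𝔟 hinf lie_e_x hxn hx𝔞 hx𝔟 hw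
  obtain rfl : ν = -μ := by
    have hmem := sub_mem (lie_mem_inf_of_mem_sup hef hyn) (heig hyn)
    have heq : ⁅e + f, y⁆ - (⁅e, y⁆ - μ • y) = (ν + μ) • y := by rw [add_lie, lie_f_y]; module
    by_contra hne
    exact hym (((𝔞 ⊓ 𝔟).toSubmodule.smul_mem_iff (mt eq_neg_of_add_eq_zero_left hne)).1
      (heq ▸ hmem))
  have lie_x_y : ⁅x, y⁆ = 0 := by simpa using lie_eq_zero_of_mem_sup_of_mem_inf hxn hxy
  obtain ⟨z, hz⟩ : ∃ z, ⁅x, e + f⁆ = z := ⟨_, rfl⟩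
  have hzm : z ∈ 𝔞 ⊓ 𝔟 := hz ▸ lie_mem_inf_of_mem_sup hxn hef
  have lie_x_f : ⁅x, f⁆ = z + μ • x := by rw [← hz, lie_add, ← lie_skew x e, lie_e_x]; abel
  have lie_e_y : ⁅e, y⁆ = z + μ • y := by
    have hcomm := lie_eq_zero_of_mem_sup_of_mem_inf hef hxy
    rw [lie_add, ← lie_skew, hz, add_lie, lie_f_y] at hcomm
    rw [← sub_eq_zero, ← hcomm]
    module
  have hF : IsAdaptedFrame 𝔢 𝔣 e x f y z :=
    h.isAdaptedFrame (N := (𝔞 ⊔ 𝔟).toSubmodule) he hen hx hxn hx0 hf hfn hy hyn hy0 fun hz =>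
      ⟨lie_x_f ▸ add_mem hz (Submodule.mem_sup_left (𝔢.smul_mem μ hx)), lie_x_y ▸ zero_mem _⟩
  have hspan := span_pair_eq_of_notMem_of_mem (S := (𝔞 ⊓ 𝔟).toSubmodule) hinf hzm hF.notMem hxy
    (Submodule.add_mem_sup hx hy) fun h0 => hx0 (h.eq_zero_of_add_eq_zero hx hy h0)
  have hmem {w} (hw : w ∈ 𝔞 ⊓ 𝔟) := Submodule.mem_span_pair.1 (hspan.ge hw)
  refine hF.hasTwistedDerivation_of_lie_eq_add h hx0 lie_e_x lie_f_y lie_x_y lie_x_f lie_e_y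
    (lie_eq_zero_of_mem_sup_of_mem_inf hxn hzm) (lie_eq_zero_of_mem_sup_of_mem_inf hyn hzm)
    (hmem ?_) (hmem (lie_mem_right ℂ 𝔤 _ e z hzm)) (hmem (lie_mem_right ℂ 𝔤 _ f z hzm))
  simpa using heig hef

end IsILCTriple

end TwoIdeals

section AntiInvolution

variable {𝔤 : Type*} [LieRing 𝔤] [LieAlgebra ℂ 𝔤] {𝔢 𝔣 : LieSubalgebra ℂ 𝔤}
  {τ : 𝔤 →ₛₗ[starRingEnd ℂ] 𝔤}

namespace IsAdmissibleAntiInvolution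

theorem apply_mem_right (hτ : IsAdmissibleAntiInvolution 𝔢 𝔣 τ) {x : 𝔤} (hx : x ∈ 𝔢) :
    τ x ∈ 𝔣 :=
  hτ.map_left.le (Submodule.mem_map_of_mem hx)

theorem apply_mem_left (hτ : IsAdmissibleAntiInvolution 𝔢 𝔣 τ) {x : 𝔤} (hx : x ∈ 𝔣) :
    τ x ∈ 𝔢 :=
  hτ.map_right.le (Submodule.mem_map_of_mem hx)

theorem apply_mem_sup (hτ : IsAdmissibleAntiInvolution 𝔢 𝔣 τ) {x : 𝔤}
    (hx : x ∈ 𝔢.toSubmodule ⊔ 𝔣.toSubmodule) : τ x ∈ 𝔢.toSubmodule ⊔ 𝔣.toSubmodule := by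
  obtain ⟨u, hu, v, hv, rfl⟩ := Submodule.mem_sup.1 hx
  rw [map_add, add_comm]
  exact Submodule.add_mem_sup (hτ.apply_mem_left hv) (hτ.apply_mem_right hu)

theorem exists_add_apply_eq (hτ : IsAdmissibleAntiInvolution 𝔢 𝔣 τ) (h : IsILCTriple 𝔢 𝔣)
    {x : 𝔤} (hx : x ∈ 𝔢.toSubmodule ⊔ 𝔣.toSubmodule) (hfix : τ x = x) :
    ∃ u ∈ 𝔢, u + τ u = x := by
  obtain ⟨u, hu, v, hv, rfl⟩ := Submodule.mem_sup.1 hx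
  refine ⟨u, hu, ?_⟩
  have hdiff : τ v - u = v - τ u := by
    rw [sub_eq_sub_iff_add_eq_add, add_comm, ← map_add, hfix, add_comm]
  have hv0 : v - τ u = 0 := h.eq_zero_of_mem
    (hdiff ▸ sub_mem (hτ.apply_mem_left hv) hu) (sub_mem hv (hτ.apply_mem_right hu))
  rw [sub_eq_zero.1 hv0]

theorem mem_map_iff (hτ : IsAdmissibleAntiInvolution 𝔢 𝔣 τ) {S : Submodule ℂ 𝔤} {x : 𝔤} :
    x ∈ S.map τ ↔ τ x ∈ S := by
  refine ⟨?_, fun hx => ⟨τ x, hx, hτ.involutive x⟩⟩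
  rintro ⟨y, hy, rfl⟩
  rwa [hτ.involutive y]

/-- The image of an ideal under an admissible anti-involution, as an ideal over `ℂ`. -/
def mapIdeal (hτ : IsAdmissibleAntiInvolution 𝔢 𝔣 τ) (I : LieIdeal ℂ 𝔤) : LieIdeal ℂ 𝔤 where
  __ := I.toSubmodule.map τ
  lie_mem := by
    rintro x _ ⟨y, hy, rfl⟩
    exact ⟨⁅τ x, y⁆, lie_mem_right ℂ 𝔤 I _ y hy, by rw [hτ.map_lie, hτ.involutive]⟩

theorem mem_mapIdeal (hτ : IsAdmissibleAntiInvolution 𝔢 𝔣 τ) {I : LieIdeal ℂ 𝔤} {x : 𝔤} :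
    x ∈ hτ.mapIdeal I ↔ τ x ∈ I :=
  hτ.mem_map_iff

theorem apply_mem_mapIdeal (hτ : IsAdmissibleAntiInvolution 𝔢 𝔣 τ) {I : LieIdeal ℂ 𝔤} {x : 𝔤}
    (hx : x ∈ I) : τ x ∈ hτ.mapIdeal I :=
  Submodule.mem_map_of_mem hx

theorem apply_mem_inf_mapIdeal (hτ : IsAdmissibleAntiInvolution 𝔢 𝔣 τ) {I : LieIdeal ℂ 𝔤} {x : 𝔤}
    (hx : x ∈ I ⊓ hτ.mapIdeal I) : τ x ∈ I ⊓ hτ.mapIdeal I :=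
  ⟨hτ.mem_mapIdeal.1 hx.2, hτ.apply_mem_mapIdeal hx.1⟩

theorem apply_mem_sup_mapIdeal (hτ : IsAdmissibleAntiInvolution 𝔢 𝔣 τ) {I : LieIdeal ℂ 𝔤} {x : 𝔤}
    (hx : x ∈ I ⊔ hτ.mapIdeal I) : τ x ∈ I ⊔ hτ.mapIdeal I := by
  obtain ⟨u, hu, v, hv, rfl⟩ := (LieSubmodule.mem_sup _ _ _).1 hx
  rw [map_add, add_comm]
  exact add_mem ((le_sup_left : I ≤ I ⊔ hτ.mapIdeal I) (hτ.mem_mapIdeal.1 hv))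
    ((le_sup_right : hτ.mapIdeal I ≤ I ⊔ hτ.mapIdeal I) (hτ.apply_mem_mapIdeal hu))

theorem isLieAbelian_mapIdeal (hτ : IsAdmissibleAntiInvolution 𝔢 𝔣 τ) (I : LieIdeal ℂ 𝔤)
    [IsLieAbelian I] : IsLieAbelian (hτ.mapIdeal I) := by
  refine ⟨fun ⟨_, x, hx, hτx⟩ ⟨_, y, hy, hτy⟩ => Subtype.ext ?_⟩
  have hxy : ⁅x, y⁆ = 0 := lie_eq_zero_of_mem hx hy
  subst hτx hτy
  exact (hτ.map_lie x y).symm.trans (by rw [hxy, map_zero]; rfl)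

theorem finrank_mapIdeal (hτ : IsAdmissibleAntiInvolution 𝔢 𝔣 τ) (I : LieIdeal ℂ 𝔤) :
    Module.finrank ℂ (hτ.mapIdeal I) = Module.finrank ℂ I :=
  finrank_map_conj hτ.involutive.injective I.toSubmodule

theorem exists_mem_notMem (hτ : IsAdmissibleAntiInvolution 𝔢 𝔣 τ) (h : IsILCTriple 𝔢 𝔣)
    {I : LieIdeal ℂ 𝔤} (hI : Module.finrank ℂ I < 5) (hτI : ∀ x ∈ I, τ x ∈ I) :
    ∃ x ∈ 𝔢, x ∉ I := by
  have := h.finiteDimensional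
  by_contra! h𝔢
  have h𝔣 x (hx : x ∈ 𝔣) : x ∈ I :=
    hτ.involutive x ▸ hτI _ (h𝔢 _ (hτ.apply_mem_left hx))
  have heq : 𝔢.toSubmodule ⊔ 𝔣.toSubmodule = I.toSubmodule :=
    Submodule.eq_of_le_of_finrank_le (sup_le h𝔢 h𝔣)
      (h.finrank_sup.symm ▸ Nat.le_of_lt_succ hI)
  have h4 := h.finrank_sup
  rw [heq, h.eq_bot_of_le_sup heq.ge] at h4
  exact absurd h4 (by rw [LieSubmodule.bot_toSubmodule, finrank_bot]; lia)

theorem eq_zero_of_mem_of_apply_mem (hτ : IsAdmissibleAntiInvolution 𝔢 𝔣 τ)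
    (h : IsILCTriple 𝔢 𝔣) {I : LieIdeal ℂ 𝔤} (hI : Module.finrank ℂ I = 2) {x : 𝔤} (hx : x ∈ 𝔢)
    (hxI : x ∈ I) (hτxI : τ x ∈ I) : x = 0 := by
  by_contra hx0
  have hτx := hτ.apply_mem_right hx
  have hτx0 : τ x ≠ 0 := (map_ne_zero_iff τ hτ.involutive.injective).2 hx0
  have hspan := span_pair_eq_of_notMem_of_mem (S := I.toSubmodule) (N := 𝔢.toSubmodule) hI hτxI
    (fun hτx' => hτx0 (h.eq_zero_of_mem hτx' hτx)) hxI hx hx0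
  have hbot := h.eq_bot_of_le_sup (hspan.ge.trans (Submodule.span_le.2 (Set.pair_subset
    (Submodule.mem_sup_right hτx) (Submodule.mem_sup_left hx))))
  rw [hbot] at hxI
  exact hx0 hxI

end IsAdmissibleAntiInvolution

namespace IsILCTriple

variable {𝔞 : LieIdeal ℂ 𝔤} [IsLieAbelian 𝔞]

theorem hasTwistedDerivation_of_finrank_inf_eq_two (h : IsILCTriple 𝔢 𝔣)
    (hτ : IsAdmissibleAntiInvolution 𝔢 𝔣 τ) (h𝔞 : Module.finrank ℂ 𝔞 = 3)
    (hinf : Module.finrank ℂ ↥(𝔞 ⊓ hτ.mapIdeal 𝔞) = 2)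
    (hsup : Module.finrank ℂ ↥(𝔞 ⊔ hτ.mapIdeal 𝔞) = 4) : HasTwistedDerivation 𝔢 𝔣 := by
  have := h.finiteDimensional
  have := hτ.isLieAbelian_mapIdeal 𝔞
  obtain ⟨ℓ, ⟨hℓm, hℓC⟩, hℓ0, hfix⟩ : ∃ ℓ ∈ (𝔞 ⊓ hτ.mapIdeal 𝔞).toSubmodule ⊓
      (𝔢.toSubmodule ⊔ 𝔣.toSubmodule), ℓ ∉ (⊥ : Submodule ℂ 𝔤) ∧ τ ℓ = ℓ := by
    refine exists_fixed_mem_notMem hτ.involutive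
      (fun x hx => ⟨hτ.apply_mem_inf_mapIdeal hx.1, hτ.apply_mem_sup hx.2⟩)
      (mt le_bot_iff.1 ((Submodule.ne_bot_iff _).2 (exists_mem_inf_ne_zero ?_)))
    rw [h.finrank_eq, h.finrank_sup]
    exact Nat.lt_of_lt_of_eq (by lia : 5 < 2 + 4) (congrArg (· + 4) hinf.symm)
  obtain ⟨x, hx, rfl⟩ := hτ.exists_add_apply_eq h hℓC hfix
  have hτx := hτ.apply_mem_right hx
  by_cases hxn : x ∈ 𝔞 ⊔ hτ.mapIdeal 𝔞
  · have hxm : x ∉ 𝔞 ⊓ hτ.mapIdeal 𝔞 := fun hxm => hℓ0 <| by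
      rw [hτ.eq_zero_of_mem_of_apply_mem h hinf hx hxm (hτ.apply_mem_inf_mapIdeal hxm), map_zero,
        add_zero]
      exact zero_mem _
    have hx𝔞 : x ∉ 𝔞 := fun hx𝔞 =>
      hxm ⟨hx𝔞, (add_mem_cancel_right (hτ.apply_mem_mapIdeal hx𝔞)).1 hℓm.2⟩
    have hx𝔟 : x ∉ hτ.mapIdeal 𝔞 := fun hx𝔟 =>
      hxm ⟨(add_mem_cancel_right (hτ.mem_mapIdeal.1 hx𝔟)).1 hℓm.1, hx𝔟⟩
    obtain ⟨e, he, hen⟩ := hτ.exists_mem_notMem h (hsup.trans_lt (by lia)) fun _ =>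
      hτ.apply_mem_sup_mapIdeal
    have hτen : τ e ∉ 𝔞 ⊔ hτ.mapIdeal 𝔞 := fun hτe =>
      hen (hτ.involutive e ▸ hτ.apply_mem_sup_mapIdeal hτe)
    obtain ⟨c, hc⟩ := exists_sub_smul_mem (S := (𝔞 ⊔ hτ.mapIdeal 𝔞).toSubmodule) le_top
      (by rw [finrank_top, h.finrank_eq]; exact congrArg (· + 1) hsup.symm)
      (Submodule.mem_top (x := τ e)) hτen (Submodule.mem_top (x := e))
    rw [sub_eq_add_neg, ← neg_smul] at hc
    exact h.hasTwistedDerivation_of_mem_sup h𝔞 ((hτ.finrank_mapIdeal 𝔞).trans h𝔞) hinf he hx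
      (𝔣.smul_mem (-c) (hτ.apply_mem_right he)) hτx hen hxn hx𝔞 hx𝔟 hc hℓm
  · obtain ⟨y, ⟨hy, hyn⟩, hy0⟩ := exists_mem_inf_ne_zero (S := 𝔢.toSubmodule)
      (N := (𝔞 ⊔ hτ.mapIdeal 𝔞).toSubmodule) (by
        rw [h.finrank_eq]
        exact Nat.lt_of_lt_of_eq (by lia : 5 < 2 + 4) (congrArg₂ _ h.finrank_left hsup).symm)
    exact h.hasTwistedDerivation_of_notMem_sup hinf hx hy hτx (hτ.apply_mem_right hy) hxn hyn hy0
      (hτ.apply_mem_sup_mapIdeal hyn) ((map_ne_zero_iff τ hτ.involutive.injective).2 hy0) hℓm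

theorem hasTwistedDerivation_of_central (h : IsILCTriple 𝔢 𝔣) {z : 𝔤} (hz0 : z ≠ 0)
    (hz : ∀ x : 𝔤, ⁅x, z⁆ = 0) (hspan : ∀ x y : 𝔤, ∃ s : ℂ, ⁅x, y⁆ = s • z) :
    HasTwistedDerivation 𝔢 𝔣 := by
  have hz' (x : 𝔤) : ⁅z, x⁆ = 0 := by rw [← lie_skew, hz, neg_zero]
  have hzC : z ∉ 𝔢.toSubmodule ⊔ 𝔣.toSubmodule := fun hzC =>
    hz0 (h.nondegenerate z hzC fun y _ => hz' y ▸ zero_mem _)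
  obtain ⟨η, hηz, hηC⟩ := Submodule.exists_le_ker_of_notMem hzC
  let D : 𝔤 →ₗ[ℂ] 𝔤 := LinearMap.id + η.smulRight ((η z)⁻¹ • z)
  have hDC x (hx : x ∈ 𝔢.toSubmodule ⊔ 𝔣.toSubmodule) : D x = x := by
    simp [D, show η x = 0 from hηC hx]
  have hDz : D z = z + z := by simp [D, hηz]
  refine ⟨D, 0, ⟨fun x y => ?_, fun x y => rfl⟩, fun hD0 => hz0 ?_, fun x hx => ?_, fun x hx => ?_⟩
  · obtain ⟨s, hs⟩ := hspan x y
    rw [hs, map_smul, hDz]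
    simp [D, hs, hz, hz']
  · rwa [hD0, LinearMap.zero_apply, eq_comm, ← two_smul ℂ,
      smul_eq_zero_iff_right two_ne_zero] at hDz
  · rwa [hDC x (Submodule.mem_sup_left hx)]
  · rwa [hDC x (Submodule.mem_sup_right hx)]

theorem hasTwistedDerivation_of_map_ne (h : IsILCTriple 𝔢 𝔣)
    (hτ : IsAdmissibleAntiInvolution 𝔢 𝔣 τ) (h𝔞 : Module.finrank ℂ 𝔞 = 3)
    (hne : 𝔞.toSubmodule.map τ ≠ 𝔞.toSubmodule) : HasTwistedDerivation 𝔢 𝔣 := by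
  have := h.finiteDimensional
  have := hτ.isLieAbelian_mapIdeal 𝔞
  have h𝔟 : Module.finrank ℂ (hτ.mapIdeal 𝔞) = 3 := (hτ.finrank_mapIdeal 𝔞).trans h𝔞
  have hsum : Module.finrank ℂ ↥(𝔞 ⊔ hτ.mapIdeal 𝔞) + Module.finrank ℂ ↥(𝔞 ⊓ hτ.mapIdeal 𝔞) =
      3 + 3 := by
    have := Submodule.finrank_sup_add_finrank_inf_eq 𝔞.toSubmodule (hτ.mapIdeal 𝔞).toSubmodule
    rw [← LieSubmodule.sup_toSubmodule, ← LieSubmodule.inf_toSubmodule] at this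
    exact this.trans (congrArg₂ _ h𝔞 h𝔟)
  have hsup : Module.finrank ℂ ↥(𝔞 ⊔ hτ.mapIdeal 𝔞) ≤ 5 :=
    (Submodule.finrank_le (𝔞 ⊔ hτ.mapIdeal 𝔞).toSubmodule).trans_eq h.finrank_eq
  have hinf : Module.finrank ℂ ↥(𝔞 ⊓ hτ.mapIdeal 𝔞) < 3 := by
    rw [← h𝔞]
    refine Submodule.finrank_lt_finrank_of_lt (lt_of_le_of_ne inf_le_left fun heq => hne ?_)
    exact (Submodule.eq_of_le_of_finrank_eq (inf_eq_left.1 heq) (h𝔞.trans h𝔟.symm)).symm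
  obtain hinf1 | hinf2 : Module.finrank ℂ ↥(𝔞 ⊓ hτ.mapIdeal 𝔞) = 1 ∨
      Module.finrank ℂ ↥(𝔞 ⊓ hτ.mapIdeal 𝔞) = 2 := by omega
  · have hsup5 : Module.finrank ℂ ↥(𝔞 ⊔ hτ.mapIdeal 𝔞) = 5 := by omega
    have htop x : x ∈ 𝔞 ⊔ hτ.mapIdeal 𝔞 := (Submodule.eq_top_of_finrank_eq
      (S := (𝔞 ⊔ hτ.mapIdeal 𝔞).toSubmodule) (hsup5.trans h.finrank_eq.symm)).ge trivial
    obtain ⟨⟨z, hzm⟩, hz0, hz⟩ := finrank_eq_one_iff'.1 hinf1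
    refine h.hasTwistedDerivation_of_central (fun h0 => hz0 (Subtype.ext h0))
      (fun x => lie_eq_zero_of_mem_sup_of_mem_inf (htop x) hzm) fun x y => ?_
    obtain ⟨s, hs⟩ := hz ⟨_, lie_mem_inf_of_mem_sup (htop x) (htop y)⟩
    exact ⟨s, congrArg Subtype.val hs.symm⟩
  · exact h.hasTwistedDerivation_of_finrank_inf_eq_two hτ h𝔞 hinf2 (by omega)

end IsILCTriple

end AntiInvolution

section Jacobi

-- These are the coefficients of `x` and `z` in the Jacobi identity of `e`, `f`, `z`.
theorem jacobi_coeff_eq_zero {R L : Type*} [CommRing R] [LieRing L] [LieAlgebra R L]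
    {e f x y z w : L} {α β u v c d : R} (hli : LinearIndependent R ![x, y, z])
    (lie_e_x : ⁅e, x⁆ = α • x) (lie_e_y : ⁅e, y⁆ = z) (lie_f_y : ⁅f, y⁆ = β • y)
    (lie_f_x : ⁅f, x⁆ = z + c • x + d • y) (lie_e_f : ⁅e, f⁆ = u • e + v • f + w)
    (lie_w_x : ⁅w, x⁆ = 0) (lie_w_y : ⁅w, y⁆ = 0) (lie_w_z : ⁅w, z⁆ = 0) :
    (u * α + v * c) * (2 * u - β + c) = 0 ∧ 2 * u * α + 2 * v * β - u * d + v * c = 0 := by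
  have lie_e_z : ⁅e, z⁆ = (u * α + v * c) • x + ((v + α) * d) • y + (v + α - d) • z := by
    have hjac := leibniz_lie e f x
    rw [lie_e_f, lie_f_x, lie_e_x, add_lie, add_lie, smul_lie, smul_lie, lie_w_x, lie_smul,
      lie_e_x, lie_f_x, lie_add, lie_add, lie_smul, lie_smul, lie_e_x, lie_e_y,
      ← sub_eq_zero] at hjac
    rw [← sub_eq_zero, ← hjac]
    module
  have lie_f_z : ⁅f, z⁆ = (β - u) • z - (v * β) • y := by
    have hjac := leibniz_lie e f y
    rw [lie_e_f, lie_f_y, lie_e_y, add_lie, add_lie, smul_lie, smul_lie, lie_w_y, lie_smul,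
      lie_e_y, lie_f_y, ← sub_eq_zero] at hjac
    rw [← sub_eq_zero, ← neg_eq_zero, ← hjac]
    module
  have hjac := leibniz_lie e f z
  rw [lie_e_f, add_lie, add_lie, smul_lie, smul_lie, lie_w_z, lie_f_z, lie_e_z, lie_sub, lie_smul,
    lie_smul, lie_e_y, lie_e_z, lie_add, lie_add, lie_smul, lie_smul, lie_smul, lie_f_x, lie_f_y,
    lie_f_z, ← sub_eq_zero] at hjac
  let coeff : Fin 3 → R := ![(u * α + v * c) * (2 * u - β + c),
    (2 * u - β) * ((v + α) * d) + (u * α + v * c) * d + (v + α) * d * β - v * (v * β)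
      - (v + α - d) * (v * β),
    2 * u * α + 2 * v * β - u * d + v * c]
  have hcoeff := Fintype.linearIndependent_iff.1 hli coeff (by
    rw [Fin.sum_univ_three]
    simp only [coeff, Matrix.cons_val]
    rw [← neg_eq_zero, ← hjac]
    module)
  exact ⟨hcoeff 0, hcoeff 2⟩

open ComplexConjugate in
theorem conj_mul_conj_eq_of_jacobi {α v c : ℂ}
    (hx : (-conj v * α + v * c) * (2 * -conj v - conj α + c) = 0)
    (hz : 2 * -conj v * α + 2 * v * conj α - -conj v * -conj c + v * c = 0) :
    conj v * conj c = v * c := by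
  rcases mul_eq_zero.1 hx with h | h
  · have h' := congrArg conj h
    simp only [map_mul, map_add, map_neg, Complex.conj_conj, map_zero] at h'
    linear_combination hz - 2 * h + 2 * h'
  · have h' := congrArg conj h
    simp only [map_mul, map_add, map_sub, map_neg, Complex.conj_conj, map_ofNat, map_zero] at h'
    linear_combination (-1 / 3) * hz - 2 / 3 * v * h + 2 / 3 * conj v * h'

end Jacobi

section InvariantIdeal

variable {𝔤 : Type*} [LieRing 𝔤] [LieAlgebra ℂ 𝔤] {𝔢 𝔣 : LieSubalgebra ℂ 𝔤}
  {τ : 𝔤 →ₛₗ[starRingEnd ℂ] 𝔤} {𝔞 : LieIdeal ℂ 𝔤} {e x f y z : 𝔤}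

namespace IsAdaptedFrame

theorem exists_eq_sum (hF : IsAdaptedFrame 𝔢 𝔣 e x f y z) (h : IsILCTriple 𝔢 𝔣) (w : 𝔤) :
    ∃ a b c d k : ℂ, w = a • e + b • x + c • f + d • y + k • z := by
  obtain ⟨B, hB⟩ := hF.exists_basis h
  refine ⟨B.repr w 0, B.repr w 1, B.repr w 2, B.repr w 3, B.repr w 4, ?_⟩
  conv_lhs => rw [← B.sum_repr w, Fin.sum_univ_five, hB]
  rfl

theorem linearIndependent (hF : IsAdaptedFrame 𝔢 𝔣 e x f y z) (h : IsILCTriple 𝔢 𝔣) :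
    LinearIndependent ℂ ![x, y, z] := by
  obtain ⟨B, hB⟩ := hF.exists_basis h
  have hli := B.linearIndependent.comp ![1, 3, 4] (by decide)
  rw [hB] at hli
  convert hli using 1
  ext i
  fin_cases i <;> rfl

theorem span_eq (hF : IsAdaptedFrame 𝔢 𝔣 e x f y z) (h : IsILCTriple 𝔢 𝔣) {S : Submodule ℂ 𝔤}
    (hS : Module.finrank ℂ S = 3) (hx : x ∈ S) (hy : y ∈ S) (hz : z ∈ S) :
    Submodule.span ℂ {x, y, z} = S := by
  have := h.finiteDimensional
  have hspan := span_range_eq_of_linearIndependent (hF.linearIndependent h) (S := S)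
    (by simp [Fin.forall_fin_succ, hx, hy, hz]) hS
  rwa [Matrix.range_cons, Matrix.range_cons_cons_empty, Set.singleton_union] at hspan

theorem apply_eq_zero_of_mem (hF : IsAdaptedFrame 𝔢 𝔣 e x f y z) (h : IsILCTriple 𝔢 𝔣)
    {S : Submodule ℂ 𝔤} (hS : Module.finrank ℂ S = 3) (hx : x ∈ S) (hy : y ∈ S) (hz : z ∈ S)
    {W : Type*} [AddCommGroup W] [Module ℂ W] {T : 𝔤 →ₗ[ℂ] W} (Tx : T x = 0) (Ty : T y = 0)
    (Tz : T z = 0) {w : 𝔤} (hw : w ∈ S) : T w = 0 := by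
  obtain ⟨p, q, r, rfl⟩ := Submodule.mem_span_triple.1 ((hF.span_eq h hS hx hy hz).ge hw)
  rw [map_add, map_add, map_smul, map_smul, map_smul, Tx, Ty, Tz, smul_zero, smul_zero,
    smul_zero, add_zero, add_zero]

theorem hasTwistedDerivation_of_lie_eq (hF : IsAdaptedFrame 𝔢 𝔣 e x f y z)
    (h : IsILCTriple 𝔢 𝔣) [IsLieAbelian 𝔞] (h𝔞 : Module.finrank ℂ 𝔞 = 3) (hx : x ∈ 𝔞)
    (hy : y ∈ 𝔞) (hz : z ∈ 𝔞) (hx0 : x ≠ 0) {α β u v c d : ℂ} {w : 𝔤} (hw : w ∈ 𝔞)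
    (lie_e_x : ⁅e, x⁆ = α • x) (lie_e_y : ⁅e, y⁆ = z) (lie_f_y : ⁅f, y⁆ = β • y)
    (lie_f_x : ⁅f, x⁆ = z + c • x + d • y) (lie_e_f : ⁅e, f⁆ = u • e + v • f + w)
    (huv : v * c = u * d) : HasTwistedDerivation 𝔢 𝔣 := by
  have lie_x_f : ⁅x, f⁆ = -(z + c • x + d • y) := by rw [← lie_skew, lie_f_x]
  have lie_x_y : ⁅x, y⁆ = 0 := lie_eq_zero_of_mem hx hy
  have lie_x_z : ⁅x, z⁆ = 0 := lie_eq_zero_of_mem hx hz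
  have lie_y_z : ⁅y, z⁆ = 0 := lie_eq_zero_of_mem hy hz
  obtain ⟨D, De, Dx, Df, Dy, Dz⟩ := hF.exists_linearMap h x 0 y 0 0
  obtain ⟨φ, φe, φx, φf, φy, φz⟩ := hF.exists_linearMap h (-v - d) 0 (u + c) 0 0
  have D𝔞 {w : 𝔤} (hw : w ∈ 𝔞) : D w = 0 :=
    hF.apply_eq_zero_of_mem h (S := 𝔞.toSubmodule) h𝔞 hx hy hz Dx Dy Dz hw
  have φ𝔞 {w : 𝔤} (hw : w ∈ 𝔞) : φ w = 0 :=
    hF.apply_eq_zero_of_mem h (S := 𝔞.toSubmodule) h𝔞 hx hy hz φx φy φz hw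
  have lie_mem (t : 𝔤) : ⁅t, z⁆ ∈ 𝔞 := lie_mem_right ℂ 𝔤 𝔞 t z hz
  refine hF.hasTwistedDerivation h (D := D) (φ := φ) (fun hD => hx0 (by rw [← De, hD]; rfl))
    (De.symm ▸ hF.left_mem) (Dx ▸ zero_mem 𝔢) (Df.symm ▸ hF.right_mem)
    (Dy ▸ zero_mem 𝔣) ?_
  simp only [List.pairwise_cons, List.mem_cons, List.not_mem_nil, or_false, TwistedAt, De, φe,
    forall_eq_or_imp, lie_e_x, map_smul, Dx, smul_zero, lie_self, lie_zero, add_zero, φx, zero_smul,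
    sub_self, smul_eq_mul, mul_zero, and_self, lie_e_f, map_add, Df, D𝔞 hw, lie_x_f, neg_add_rev,
    lie_e_y, φf, φ𝔞 hw, Dz, lie_x_y, Dy, φy, φz, forall_eq, D𝔞 (lie_mem _), lie_x_z, φ𝔞 (lie_mem _),
    and_true, true_and, zero_lie, zero_add, sub_zero, map_neg, neg_zero, map_zero, lie_f_y, lie_y_z,
    IsEmpty.forall_iff, implies_true, List.Pairwise.nil]
  exact ⟨by module, by linear_combination huv⟩

end IsAdaptedFrame

open ComplexConjugate

namespace IsAdmissibleAntiInvolution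

theorem isAdaptedFrame_of_mem [IsLieAbelian 𝔞] (hτ : IsAdmissibleAntiInvolution 𝔢 𝔣 τ)
    (h : IsILCTriple 𝔢 𝔣) (hτ𝔞 : ∀ x ∈ 𝔞, τ x ∈ 𝔞) (he : e ∈ 𝔢) (he𝔞 : e ∉ 𝔞) (hx : x ∈ 𝔢)
    (hx𝔞 : x ∈ 𝔞) (hx0 : x ≠ 0) : IsAdaptedFrame 𝔢 𝔣 e x (τ e) (τ x) ⁅e, τ x⁆ := by
  have hτe : τ e ∉ 𝔞 := fun hτe => he𝔞 (hτ.involutive e ▸ hτ𝔞 _ hτe)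
  refine h.isAdaptedFrame (N := 𝔞.toSubmodule) he he𝔞 hx hx𝔞 hx0 (hτ.apply_mem_right he) hτe
    (hτ.apply_mem_right hx) (hτ𝔞 x hx𝔞) ((map_ne_zero_iff τ hτ.involutive.injective).2 hx0)
    fun hz => ⟨?_, lie_eq_zero_of_mem hx𝔞 (hτ𝔞 x hx𝔞) ▸ zero_mem _⟩
  have hτz := hτ.apply_mem_sup hz
  rw [hτ.map_lie, hτ.involutive] at hτz
  exact lie_skew x (τ e) ▸ neg_mem hτz

-- A `τ`-fixed vector of `𝔞` outside `𝔢 ⊔ 𝔣` fixes the scaling of `x`.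
theorem exists_lie_apply_eq_add [IsLieAbelian 𝔞] (hτ : IsAdmissibleAntiInvolution 𝔢 𝔣 τ)
    (h : IsILCTriple 𝔢 𝔣) (h𝔞 : Module.finrank ℂ 𝔞 = 3) (hτ𝔞 : ∀ x ∈ 𝔞, τ x ∈ 𝔞) (he : e ∈ 𝔢)
    (he𝔞 : e ∉ 𝔞) (hx : x ∈ 𝔢) (hx𝔞 : x ∈ 𝔞) (hx0 : x ≠ 0) :
    ∃ x' ∈ 𝔢, x' ∈ 𝔞 ∧ x' ≠ 0 ∧
      ∃ c : ℂ, ⁅τ e, x'⁆ = ⁅e, τ x'⁆ + c • x' + -conj c • τ x' := by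
  have hF := hτ.isAdaptedFrame_of_mem h hτ𝔞 he he𝔞 hx hx𝔞 hx0
  have hz𝔞 : ⁅e, τ x⁆ ∈ 𝔞 := lie_mem_right ℂ 𝔤 𝔞 e _ (hτ𝔞 x hx𝔞)
  obtain ⟨ζ, hζ𝔞, hζC, hfix⟩ := exists_fixed_mem_notMem hτ.involutive (A := 𝔞.toSubmodule) hτ𝔞
    fun hle => hF.notMem (hle hz𝔞)
  obtain ⟨p, q, r, rfl⟩ :=
    Submodule.mem_span_triple.1 ((hF.span_eq h h𝔞 hx𝔞 (hτ𝔞 x hx𝔞) hz𝔞).ge hζ𝔞)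
  have hr : r ≠ 0 := by
    rintro rfl
    rw [zero_smul, add_zero] at hζC
    exact hζC (Submodule.add_mem_sup (𝔢.smul_mem p hx)
      (𝔣.smul_mem q (hτ.apply_mem_right hx)))
  have hr' : conj r ≠ 0 := (map_ne_zero _).2 hr
  refine ⟨conj r • x, 𝔢.smul_mem _ hx, 𝔞.smul_mem _ hx𝔞, smul_ne_zero hr' hx0,
    (p - conj q) / conj r, ?_⟩
  simp only [map_add, map_smulₛₗ, hτ.map_lie, hτ.involutive x] at hfix
  simp only [map_smulₛₗ, lie_smul, map_div₀, map_sub, Complex.conj_conj, smul_smul,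
    div_mul_cancel₀ _ hr', div_mul_cancel₀ _ hr, neg_mul]
  rw [← sub_eq_zero] at hfix ⊢
  rw [← hfix]
  module

theorem exists_lie_apply_eq (hτ : IsAdmissibleAntiInvolution 𝔢 𝔣 τ)
    (h : IsILCTriple 𝔢 𝔣) (h𝔞 : Module.finrank ℂ 𝔞 = 3) (hτ𝔞 : ∀ x ∈ 𝔞, τ x ∈ 𝔞)
    (hF : IsAdaptedFrame 𝔢 𝔣 e x (τ e) y z) (hx : x ∈ 𝔞) (hy : y ∈ 𝔞) (hz : z ∈ 𝔞) :
    ∃ v : ℂ, ∃ w ∈ 𝔞, ⁅e, τ e⁆ = -conj v • e + v • τ e + w := by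
  obtain ⟨u, v, w, hw, huv⟩ : ∃ u v : ℂ, ∃ w ∈ 𝔞, ⁅e, τ e⁆ = u • e + v • τ e + w := by
    obtain ⟨u, b, v, d, k, huv⟩ := hF.exists_eq_sum h ⁅e, τ e⁆
    refine ⟨u, v, b • x + d • y + k • z, ?_, by rw [huv]; abel⟩
    exact add_mem (add_mem (𝔞.smul_mem b hx) (𝔞.smul_mem d hy)) (𝔞.smul_mem k hz)
  obtain ⟨T, Te, Tx, Tf, Ty, Tz⟩ := hF.exists_linearMap h (1 : ℂ) 0 0 0 0
  have T𝔞 {w : 𝔤} (hw : w ∈ 𝔞) : T w = 0 :=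
    hF.apply_eq_zero_of_mem h (S := 𝔞.toSubmodule) h𝔞 hx hy hz Tx Ty Tz hw
  have hu : conj v + u = 0 := by
    have hskew : τ ⁅e, τ e⁆ + ⁅e, τ e⁆ = 0 := by
      rw [hτ.map_lie, hτ.involutive, ← lie_skew, neg_add_cancel]
    rw [huv, map_add, map_add, map_smulₛₗ, map_smulₛₗ, hτ.involutive] at hskew
    simpa [Te, Tf, T𝔞 hw, T𝔞 (hτ𝔞 _ hw)] using congrArg T hskew
  exact ⟨v, w, hw, eq_neg_of_add_eq_zero_right hu ▸ huv⟩

end IsAdmissibleAntiInvolution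

theorem IsILCTriple.hasTwistedDerivation_of_mem [IsLieAbelian 𝔞] (h : IsILCTriple 𝔢 𝔣)
    (hτ : IsAdmissibleAntiInvolution 𝔢 𝔣 τ) (h𝔞 : Module.finrank ℂ 𝔞 = 3)
    (hτ𝔞 : ∀ x ∈ 𝔞, τ x ∈ 𝔞) (hx : x ∈ 𝔢) (hx𝔞 : x ∈ 𝔞) (hx0 : x ≠ 0) :
    HasTwistedDerivation 𝔢 𝔣 := by
  obtain ⟨e, he, he𝔞⟩ := hτ.exists_mem_notMem h (h𝔞.trans_lt (by lia)) hτ𝔞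
  obtain ⟨x, hx, hx𝔞, hx0, c, lie_f_x⟩ :=
    hτ.exists_lie_apply_eq_add h h𝔞 hτ𝔞 he he𝔞 hx hx𝔞 hx0
  have hF := hτ.isAdaptedFrame_of_mem h hτ𝔞 he he𝔞 hx hx𝔞 hx0
  have hy𝔞 := hτ𝔞 x hx𝔞
  have hz𝔞 : ⁅e, τ x⁆ ∈ 𝔞 := lie_mem_right ℂ 𝔤 𝔞 e _ hy𝔞
  obtain ⟨α, lie_e_x⟩ := exists_lie_eq_smul h.finrank_left he he𝔞 hx hx𝔞 hx0
  have lie_f_y : ⁅τ e, τ x⁆ = conj α • τ x := by rw [← hτ.map_lie, lie_e_x, map_smulₛₗ]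
  obtain ⟨v, w, hw, lie_e_f⟩ := hτ.exists_lie_apply_eq h h𝔞 hτ𝔞 hF hx𝔞 hy𝔞 hz𝔞
  obtain ⟨jacobi_x, jacobi_z⟩ := jacobi_coeff_eq_zero (hF.linearIndependent h) lie_e_x rfl lie_f_y
    lie_f_x lie_e_f (lie_eq_zero_of_mem hw hx𝔞) (lie_eq_zero_of_mem hw hy𝔞)
    (lie_eq_zero_of_mem hw hz𝔞)
  refine hF.hasTwistedDerivation_of_lie_eq h h𝔞 hx𝔞 hy𝔞 hz𝔞 hx0 hw lie_e_x rfl lie_f_y lie_f_x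
    lie_e_f ?_
  rw [neg_mul_neg, conj_mul_conj_eq_of_jacobi jacobi_x jacobi_z]

end InvariantIdeal

theorem theorem4p1
    {𝔤 : Type*} [LieRing 𝔤] [LieAlgebra ℂ 𝔤]
    (𝔢 𝔣 : LieSubalgebra ℂ 𝔤) (h𝔢𝔣 : IsILCTriple 𝔢 𝔣)
    (τ : 𝔤 →ₛₗ[starRingEnd ℂ] 𝔤) (hτ : IsAdmissibleAntiInvolution 𝔢 𝔣 τ)
    (𝔞 : LieIdeal ℂ 𝔤) (h𝔞 : Module.finrank ℂ 𝔞 = 3) (h𝔞_abelian : IsLieAbelian 𝔞)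
    {E : Type*} [NormedAddCommGroup E] [NormedSpace ℂ E] [CompleteSpace E]
    {G : Type*} [TopologicalSpace G] [ChartedSpace E G] [Group G] [LieGroup 𝓘(ℂ, E) ω G]
    (ι : 𝔤 ≃ₗ⁅ℂ⁆ GroupLieAlgebra 𝓘(ℂ, E) G)
    (hdim : ilcSymDim ι 𝔢 𝔣 = 5) :
    𝔞.toSubmodule.map τ = 𝔞.toSubmodule ∧
      𝔢.toSubmodule ⊓ 𝔞.toSubmodule = ⊥ ∧ 𝔣.toSubmodule ⊓ 𝔞.toSubmodule = ⊥ := by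
  have := h𝔢𝔣.finiteDimensional
  have : FiniteDimensional ℂ E := Module.Finite.equiv (modelEquiv ι).symm
  have : LieAlgebra.IsSolvable 𝔤 :=
    isSolvable_of_isLieAbelian_of_finrank 𝔞 (by rw [h𝔢𝔣.finrank_eq, h𝔞])
  have hnone : ¬ HasTwistedDerivation 𝔢 𝔣 := by
    rintro ⟨D, φ, hD, hD0, hD𝔢, hD𝔣⟩
    have h6 := finrank_add_one_le_ilcSymDim ι 𝔢 𝔣 hD hD0 hD𝔢 hD𝔣
    rw [hdim, h𝔢𝔣.finrank_eq] at h6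
    exact absurd h6 (by norm_num)
  have hmap : 𝔞.toSubmodule.map τ = 𝔞.toSubmodule := by
    by_contra hne
    exact hnone (h𝔢𝔣.hasTwistedDerivation_of_map_ne hτ h𝔞 hne)
  have hτ𝔞 x (hx : x ∈ 𝔞) : τ x ∈ 𝔞 := hmap.le (Submodule.mem_map_of_mem hx)
  have hleft x (hx : x ∈ 𝔢) (hx𝔞 : x ∈ 𝔞) : x = 0 := by
    by_contra hx0
    exact hnone (h𝔢𝔣.hasTwistedDerivation_of_mem hτ h𝔞 hτ𝔞 hx hx𝔞 hx0)
  refine ⟨hmap, (Submodule.eq_bot_iff _).2 fun x hx => hleft x hx.1 hx.2,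
    (Submodule.eq_bot_iff _).2 fun x hx => ?_⟩
  rw [← hτ.involutive x, hleft _ (hτ.apply_mem_left hx.1) (hτ𝔞 x hx.2), map_zero]
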